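/- **Theorem (Stabilization can be hard).** A linear system $S=(A,B,H)$ with state dimension $n\ge 1$ and input dimension $p$ evolves as $$x_{k+1}=Ax_k+Bu_k+Hw_k,\qquad x_0=0,\qquad w_k\overset{\text{i.i.d.}}{\sim}\mathcal N(0,I_r),$$ with $A\in\mathbb R^{n\times n}$, $B\in\mathbb R^{n\times p}$, $H\in\mathbb R^{n\times r}$, where the noise dimension $r$ is part of the unknown system. Let $\mathcal C_k=[B\;AB\;\cdots\;A^{k-1}B]$. The pair $(A,B)$ is controllable if $\operatorname{rank}\mathcal C_k=n$ for some $k\le n$, and its controllability index is $\kappa(A,B)=\min\{k\ge1:\operatorname{rank}\mathcal C_k=n\}$. For a controllable pair with index $\kappa$ there is an orthogonal $U$ such that, with blocks of sizes $p_i=\operatorname{rank}\mathcal C_i-\operatorname{rank}\mathcal C_{i-1}$, $1\le i\le\kappa$, only the first block row $B_1$ of $U'B$ is non-zero and $U'AU=(A_{i,j})$ satisfies $A_{i,j}=0$ for $i>j+1$ (staircase form). For $\mu>0$ the pair is called $\mu$-robustly coupled if it is controllable and $\sigma_p(B_1)\ge\mu$ and $\sigma_{p_{i+1}}(A_{i+1,i})\ge\mu$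 for all $1\le i\le\kappa-1$, where $\sigma_k$ is the $k$-th largest singular value. Let $0<\mu<1$ and $M\ge1$, and, if $\kappa\ge2$, let $M\ge\sqrt{1+\mu^2}$. Let $\mathscr C$ be the class of all systems with state dimension $n$ and input dimension $p$ for which $(A,B)$ is $\mu$-robustly coupled with controllability index $\kappa$, $\|A\|_2,\|B\|_2,\|H\|_2\le M$, $\operatorname{rank}B=p$, $\operatorname{rank}H=r$, and $\rho(A)\le1$ (spectral radius). Assume that $\mathscr C$ is non-empty. Let $N\ge0$. An exploration policy $\pi$ chooses $u_t$, $t<N$, as a measurable function of $x_0,\dots,x_t,u_0,\dots,u_{t-1}$ and of an auxiliary random signal that is independent of the noise and whose law does not depend on the system. A gain estimator $\hat K_N$ is a measurable function from the data $(u_0,x_1),\dots,(u_{N-1},x_N)$ to $\mathbb R^{p\times n}$. Let $\sigma_u>0$ and suppose that $\mathbb E_{S,\pi}\|u_t\|_2^2\le\sigma_u^2$ for all $S\in\mathscr C$ and all $t<N$. Let $0\le\delta<1/2$. If $$\sup_{S\in\mathscr C}\mathbb P_{S,\pi}\big(\rho(A+B\hat K_N)\ge1\big)\le\delta,$$ then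 $$N\sigma_u^2\;\ge\;\frac12\Big(\frac1\mu\Big)^{2\kappa-2}\Big(\frac{1-\mu}{\mu}\Big)^{2}\log\frac1{3\delta},$$ where for $\delta=0$ the right-hand side is $+\infty$, i.e. the requirement cannot be met with $\delta=0$. -/

import Mathlib

open MeasureTheory ProbabilityTheory
open scoped ENNReal Matrix Matrix.Norms.L2Operator

/-- A linear system `S = (A, B, H)` with state dimension `n` and input dimension `p`; the noise
dimension `r` is part of the system:  `x (k+1) = A x k + B u k + H w k`. -/
structure LinSys (n p : ℕ) where
  r : ℕ
  A : Matrix (Fin n) (Fin n) ℝ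
  B : Matrix (Fin n) (Fin p) ℝ
  H : Matrix (Fin n) (Fin r) ℝ

/-- The spectral radius of a real square matrix: the largest modulus of a complex eigenvalue. -/
noncomputable def rho {n : ℕ} (A : Matrix (Fin n) (Fin n) ℝ) : ℝ≥0∞ :=
  spectralRadius ℂ (A.map (algebraMap ℝ ℂ))

/-- The `k`-th largest singular value `σ_k` (`k = 1, 2, …`) of a real matrix. -/
noncomputable def sigmaVal {a b : ℕ} (k : ℕ) (M : Matrix (Fin a) (Fin b) ℝ) : ℝ :=
  (Matrix.toEuclideanLin M).singularValues (k - 1)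

section Controllability

/-- The controllability matrix `[B, AB, …, A^(k-1) B]`; its columns are indexed by pairs
(power of `A`, column of `B`). -/
def ctrbMatrix {n p : ℕ} (A : Matrix (Fin n) (Fin n) ℝ) (B : Matrix (Fin n) (Fin p) ℝ) (k : ℕ) :
    Matrix (Fin n) (Fin k × Fin p) ℝ :=
  Matrix.of fun i tj => (A ^ (tj.1 : ℕ) * B) i tj.2

/-- `(A, B)` is controllable: the controllability matrix has rank `n` for some `k ≤ n`. -/
def IsControllable {n p : ℕ} (A : Matrix (Fin n) (Fin n) ℝ) (B : Matrix (Fin n) (Fin p) ℝ) :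
    Prop :=
  ∃ k ≤ n, (ctrbMatrix A B k).rank = n

/-- The controllability index `κ(A, B) = min {k ≥ 1 : rank C_k = n}` (used for controllable
pairs only). -/
noncomputable def ctrbIndex {n p : ℕ} (A : Matrix (Fin n) (Fin n) ℝ)
    (B : Matrix (Fin n) (Fin p) ℝ) : ℕ :=
  sInf {k : ℕ | 1 ≤ k ∧ (ctrbMatrix A B k).rank = n}

/-- The size `rank C_(i+1) - rank C_i` of the `i`-th diagonal block (`i = 0, 1, …`) of the
staircase form. -/
noncomputable def blockSize {n p : ℕ} (A : Matrix (Fin n) (Fin n) ℝ)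
    (B : Matrix (Fin n) (Fin p) ℝ) (i : ℕ) : ℕ :=
  (ctrbMatrix A B (i + 1)).rank - (ctrbMatrix A B i).rank

/-- Coordinates of the staircase form: a block number together with a position in that block. -/
abbrev StairIdx {n p : ℕ} (A : Matrix (Fin n) (Fin n) ℝ) (B : Matrix (Fin n) (Fin p) ℝ) : Type :=
  (i : Fin (ctrbIndex A B)) × Fin (blockSize A B i)

/-- The `i`-th block row of `Uᵀ B`. -/
noncomputable def inputBlock {n p : ℕ} (A : Matrix (Fin n) (Fin n) ℝ) (B : Matrix (Fin n) (Fin p) ℝ)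
    (U : Matrix (Fin n) (StairIdx A B) ℝ) (i : Fin (ctrbIndex A B)) :
    Matrix (Fin (blockSize A B i)) (Fin p) ℝ :=
  (Uᵀ * B).submatrix (fun a => ⟨i, a⟩) id

/-- The `(i, j)` block of `Uᵀ A U`. -/
noncomputable def stateBlock {n p : ℕ} (A : Matrix (Fin n) (Fin n) ℝ) (B : Matrix (Fin n) (Fin p) ℝ)
    (U : Matrix (Fin n) (StairIdx A B) ℝ) (i j : Fin (ctrbIndex A B)) :
    Matrix (Fin (blockSize A B i)) (Fin (blockSize A B j)) ℝ :=
  (Uᵀ * A * U).submatrix (fun a => ⟨i, a⟩) (fun b => ⟨j, b⟩)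

/-- The orthogonal matrix `U` brings `(A, B)` into staircase (block Hessenberg) form: only the
first block row of `Uᵀ B` is non-zero, and `Uᵀ A U` vanishes below its block subdiagonal. -/
structure IsStaircase {n p : ℕ} (A : Matrix (Fin n) (Fin n) ℝ) (B : Matrix (Fin n) (Fin p) ℝ)
    (U : Matrix (Fin n) (StairIdx A B) ℝ) : Prop where
  transpose_mul : Uᵀ * U = 1
  mul_transpose : U * Uᵀ = 1
  input_zero : ∀ i : Fin (ctrbIndex A B), 0 < (i : ℕ) → inputBlock A B U i = 0
  state_zero : ∀ i j : Fin (ctrbIndex A B), (j : ℕ) + 1 < (i : ℕ) → stateBlock A B U i j = 0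

/-- `(A, B)` is `μ`-robustly coupled: it is controllable and, in staircase form, `σ_p(B_1) ≥ μ`
and `σ_(p_(i+1))(A_(i+1,i)) ≥ μ` for all consecutive blocks. (The staircase form is unique up to
orthogonal changes of basis inside the blocks, which do not change these singular values.) -/
def IsRobustlyCoupled {n p : ℕ} (μ : ℝ) (A : Matrix (Fin n) (Fin n) ℝ)
    (B : Matrix (Fin n) (Fin p) ℝ) : Prop :=
  0 < μ ∧ IsControllable A B ∧ ∃ U : Matrix (Fin n) (StairIdx A B) ℝ, IsStaircase A B U ∧
    (∀ i : Fin (ctrbIndex A B), (i : ℕ) = 0 → μ ≤ sigmaVal p (inputBlock A B U i)) ∧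
    (∀ i j : Fin (ctrbIndex A B), (j : ℕ) = (i : ℕ) + 1 →
      μ ≤ sigmaVal (blockSize A B j) (stateBlock A B U j i))

/-- The class of all `μ`-robustly coupled systems of state dimension `n`, input dimension `p` and
controllability index `κ`, with the general conditions on the system: `A, B, H` have spectral norm
at most `M`, `B` and `H` have full column rank (`r ≤ n`), and `ρ(A) ≤ 1`. Norms of matrices are
spectral norms here. -/
def robustClass (n p κ : ℕ) (μ M : ℝ) : Set (LinSys n p) :=
  {S | ‖S.A‖ ≤ M ∧ ‖S.B‖ ≤ M ∧ ‖S.H‖ ≤ M ∧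
    S.B.rank = p ∧ S.H.rank = S.r ∧ rho S.A ≤ 1 ∧
    IsRobustlyCoupled μ S.A S.B ∧ ctrbIndex S.A S.B = κ}

end Controllability

section Experiment

/-- `ℝ^d` with the Euclidean norm. -/
abbrev Vec (d : ℕ) : Type := EuclideanSpace ℝ (Fin d)

/-- An exploration policy: at time `t` the input is a measurable function of
`x_0, …, x_t`, of `u_0, …, u_(t-1)` and of an auxiliary randomization signal in `𝒜`. -/
structure Policy (n p : ℕ) (𝒜 : Type*) [MeasurableSpace 𝒜] where
  act : (t : ℕ) → (Fin (t + 1) → Vec n) × (Fin t → Vec p) × 𝒜 → Vec p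
  measurable_act : ∀ t, Measurable (act t)

/-- A gain estimator: a measurable map from the data `(u_0, x_1), …, (u_(N-1), x_N)` to a
feedback gain (a `p × n` matrix). -/
structure GainEstimator (n p N : ℕ) where
  gain : (Fin N → Vec p × Vec n) → Matrix (Fin p) (Fin n) ℝ
  measurable_gain : ∀ i j, Measurable fun d => gain d i j

variable {n p : ℕ} {𝒜 : Type*} [MeasurableSpace 𝒜]

/-- The history `(x_0, …, x_t)`, `(u_0, …, u_(t-1))` of the closed loop of the system `S` and the
policy, started at `x_0 = 0`, for a realization `a` of the auxiliary signal and `w` of the noise. -/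
noncomputable def history (S : LinSys n p) (pol : Policy n p 𝒜) (a : 𝒜) (w : ℕ → Vec S.r) :
    (t : ℕ) → (Fin (t + 1) → Vec n) × (Fin t → Vec p)
  | 0 => (fun _ => 0, Fin.elim0)
  | t + 1 =>
    let h := history S pol a w t
    let u : Vec p := pol.act t (h.1, h.2, a)
    (Fin.snoc (α := fun _ => Vec n) h.1
      (Matrix.toEuclideanLin S.A (h.1 (Fin.last t)) + Matrix.toEuclideanLin S.B u
        + Matrix.toEuclideanLin S.H (w t)),
     Fin.snoc (α := fun _ => Vec p) h.2 u)

/-- The data `(u_0, x_1), …, (u_(N-1), x_N)`. -/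
noncomputable def ioData (S : LinSys n p) (pol : Policy n p 𝒜) (N : ℕ)
    (ω : 𝒜 × (ℕ → Vec S.r)) : Fin N → Vec p × Vec n :=
  fun t => ((history S pol ω.1 ω.2 N).2 t, (history S pol ω.1 ω.2 N).1 t.succ)

/-- The law of the data, when the auxiliary signal has law `ν` and is independent of
the noise `w_0, w_1, …`, which is i.i.d. standard Gaussian in `ℝ^r`. -/
noncomputable def dataLaw (S : LinSys n p) (pol : Policy n p 𝒜) (ν : Measure 𝒜) (N : ℕ) :
    Measure (Fin N → Vec p × Vec n) :=
  (ν.prod (Measure.infinitePi fun _ : ℕ => stdGaussian (Vec S.r))).map (ioData S pol N)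

/-- The input budget `E ‖u_t‖² ≤ σ²` for all `t < N`, under the system `S`. -/
def EnergyBounded (S : LinSys n p) (pol : Policy n p 𝒜) (ν : Measure 𝒜) (N : ℕ) (σ : ℝ) : Prop :=
  ∀ t : Fin N, ∫⁻ d, ‖(d t).1‖ₑ ^ 2 ∂(dataLaw S pol ν N) ≤ ENNReal.ofReal (σ ^ 2)

/-- The probability that the estimated gain fails to stabilize the system `S`:
`P (ρ(A + B K) ≥ 1)`. -/
noncomputable def failureProb (S : LinSys n p) (pol : Policy n p 𝒜) (ν : Measure 𝒜) (N : ℕ)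
    (K : GainEstimator n p N) : ℝ≥0∞ :=
  dataLaw S pol ν N {d | 1 ≤ rho (S.A + S.B * K.gain d)}

end Experiment

/-! The bound comes from two systems in the class that no single gain can stabilize and that data
barely tell apart. The block sizes of the given system are non-increasing, so its coordinates can be
rearranged into chains: the inputs drive the first block with gain `μ`, and each later block is
driven with gain `μ` by the one before. One coordinate `y` of the last block also integrates and
receives the only noise. Its driving signal enters with sign `ε = 1` or `ε = -1`.

Because of the integrator, the diagonal entry of `1 - A` at `y` vanishes, so row `y` of `1 - (A + B
K)` is proportional to `ε`, and `det (1 - (A + B K))` changes sign with `ε` (`det_one_sub_chain`). A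
non-positive determinant excludes Schur stability (`one_le_rho_of_det_nonpos`), so the sign of the
determinant at the estimated gain is a test between the two systems, with both errors at most `δ`.

Flipping `ε` shifts the noise by twice the signal that drives `y`. This signal is an input
attenuated by `μ` once per block, with second moment at most `μ ^ (2 * κ) * σ ^ 2`
(`StairShape.lintegral_chainDrive_le`). The relative entropy of the two data laws is half the
expected energy of the shift, hence at most `2 * N * μ ^ (2 * κ) * σ ^ 2`. It is handled in
Donsker–Varadhan form, `∫ f dQ ≤ log ∫ exp f dP + D` for bounded `f`, which avoids densities on path
space (`integral_historyLaw_le_log_integral_exp`). A test with errors `δ` needs `D ≥ log (1 / (3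
δ))` (`log_le_of_forall_variational`). -/

/-! ### Shifted Gaussians and the variational inequality for one noise vector -/

/-- Cameron–Martin formula for the standard Gaussian on the line. -/
theorem integral_gaussianReal_shift (f : ℝ → ℝ) (s : ℝ) :
    ∫ w, f w ∂(gaussianReal 0 1) =
      ∫ w, Real.exp (-s * w - s ^ 2 / 2) * f (w + s) ∂(gaussianReal 0 1) := by
  rw [integral_gaussianReal_eq_integral_smul one_ne_zero,
    integral_gaussianReal_eq_integral_smul one_ne_zero,
    ← integral_add_right_eq_self (μ := volume) _ s]
  refine integral_congr_ae (.of_forall fun w => ?_)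
  simp only [gaussianPDFReal, smul_eq_mul, ← mul_assoc, NNReal.coe_one]
  rw [mul_assoc _ (Real.exp _) (Real.exp _), ← Real.exp_add]
  ring_nf

theorem integrable_of_bounded {Ω : Type*} [MeasurableSpace Ω] {P : Measure Ω} [IsFiniteMeasure P]
    {f : Ω → ℝ} (hf : Measurable f) {C : ℝ} (hC : ∀ x, |f x| ≤ C) : Integrable f P :=
  Integrable.of_bound hf.aestronglyMeasurable C (.of_forall hC)

/-- One step of the variational inequality: the relative entropy of a shifted Gaussian. -/
theorem integral_comp_add_le_log_integral_exp {g : ℝ → ℝ} (hg : Measurable g) {C : ℝ}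
    (hC : ∀ x, |g x| ≤ C) (s : ℝ) :
    ∫ w, g (w + s) ∂(gaussianReal 0 1) ≤
      Real.log (∫ w, Real.exp (g w) ∂(gaussianReal 0 1)) + s ^ 2 / 2 := by
  have hgs : Integrable (fun w => g (w + s)) (gaussianReal 0 1) :=
    integrable_of_bounded (by fun_prop) fun w => hC (w + s)
  have hid : Integrable (fun w : ℝ => w) (gaussianReal 0 1) :=
    (memLp_id_gaussianReal 1).integrable le_rfl
  have hlin : Integrable (fun w => -s * w - s ^ 2 / 2) (gaussianReal 0 1) :=
    (hid.const_mul _).sub (integrable_const _)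
  have hφ : Integrable (fun w => (-s * w - s ^ 2 / 2) + g (w + s)) (gaussianReal 0 1) :=
    hlin.add hgs
  have hexp : Integrable (fun w => Real.exp (-s * w - s ^ 2 / 2) * Real.exp (g (w + s)))
      (gaussianReal 0 1) := by
    refine Integrable.mul_bdd (c := Real.exp C) ?_
      ((Real.measurable_exp.comp (hg.comp (measurable_add_const s))).aestronglyMeasurable)
      (.of_forall fun w => ?_)
    · simp only [sub_eq_add_neg, Real.exp_add]
      exact (integrable_exp_mul_gaussianReal (-s)).mul_const _
    · rw [Real.norm_eq_abs, Real.abs_exp]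
      exact Real.exp_le_exp.2 ((abs_le.1 (hC _)).2)
  have hval : ∫ w, (-s * w - s ^ 2 / 2) + g (w + s) ∂(gaussianReal 0 1) =
      ∫ w, g (w + s) ∂(gaussianReal 0 1) - s ^ 2 / 2 := by
    rw [integral_add hlin hgs, integral_sub (hid.const_mul _) (integrable_const _),
      integral_const_mul, integral_id_gaussianReal]
    simp; ring
  -- Jensen for the tilted exponent: its linear part is centred, so its mean is the mean of `g (w +
  -- s)` minus `s ^ 2 / 2`, while the integral of its exponential is that of `exp g` by the shift
  -- formula.
  have hJ := convexOn_exp.map_integral_le (μ := gaussianReal 0 1) (f := fun w =>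
    (-s * w - s ^ 2 / 2) + g (w + s)) Real.continuous_exp.continuousOn isClosed_univ
    (.of_forall fun _ => Set.mem_univ _) hφ (by simpa only [Function.comp_def, Real.exp_add] using hexp)
  simp only [hval, Real.exp_add (-s * _ - s ^ 2 / 2)] at hJ
  rw [← integral_gaussianReal_shift (fun w => Real.exp (g w)) s] at hJ
  have := Real.log_le_log (Real.exp_pos _) hJ
  rw [Real.log_exp] at this
  linarith

theorem stdGaussian_vec_one :
    stdGaussian (Vec 1) =
      (gaussianReal 0 1).map (fun x : ℝ => (WithLp.toLp 2 (fun _ => x) : Vec 1)) := by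
  rw [← map_pi_eq_stdGaussian, ← (measurePreserving_piUnique fun _ : Fin 1 =>
    gaussianReal 0 1).symm.map_eq, Measure.map_map (by fun_prop) (by fun_prop)]
  rfl

theorem integral_add_le_log_integral_exp_stdGaussian {g : Vec 1 → ℝ} (hg : Measurable g) {C : ℝ}
    (hC : ∀ x, |g x| ≤ C) (v : Vec 1) :
    ∫ w, g (w + v) ∂(stdGaussian (Vec 1)) ≤
      Real.log (∫ w, Real.exp (g w) ∂(stdGaussian (Vec 1))) + ‖v‖ ^ 2 / 2 := by
  have hm : Measurable (fun x : ℝ => (WithLp.toLp 2 (fun _ => x) : Vec 1)) := by fun_prop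
  rw [stdGaussian_vec_one, integral_map (f := fun w => g (w + v)) hm.aemeasurable
      (hg.comp (measurable_add_const v)).aestronglyMeasurable,
    integral_map (f := fun w => Real.exp (g w)) hm.aemeasurable
      (Real.measurable_exp.comp hg).aestronglyMeasurable]
  convert integral_comp_add_le_log_integral_exp (g := fun x => g (WithLp.toLp 2 (fun _ => x)))
    (hg.comp hm) (fun x => hC _) (v 0) using 3 with w
  · congr 1
    ext i
    simp [Subsingleton.elim i 0]
  · rw [EuclideanSpace.real_norm_sq_eq]; simp

/-! ### Laws of closed-loop histories -/

section HistoryLaw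

variable {n p : ℕ} {𝒜 : Type*} [MeasurableSpace 𝒜]

/-- One step of the closed loop on histories, driven by one noise vector. -/
noncomputable def historyStep (S : LinSys n p) (pol : Policy n p 𝒜) (t : ℕ)
    (z : (𝒜 × ((Fin (t + 1) → Vec n) × (Fin t → Vec p))) × Vec S.r) :
    𝒜 × ((Fin (t + 2) → Vec n) × (Fin (t + 1) → Vec p)) :=
  (z.1.1,
    (Fin.snoc (α := fun _ => Vec n) z.1.2.1
      (Matrix.toEuclideanLin S.A (z.1.2.1 (Fin.last t))
        + Matrix.toEuclideanLin S.B (pol.act t (z.1.2.1, z.1.2.2, z.1.1))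
        + Matrix.toEuclideanLin S.H z.2),
     Fin.snoc (α := fun _ => Vec p) z.1.2.2 (pol.act t (z.1.2.1, z.1.2.2, z.1.1))))

/-- The auxiliary signal together with the history up to time `t`. -/
noncomputable def signalHistory (S : LinSys n p) (pol : Policy n p 𝒜) (t : ℕ)
    (ω : 𝒜 × (ℕ → Vec S.r)) : 𝒜 × ((Fin (t + 1) → Vec n) × (Fin t → Vec p)) :=
  (ω.1, history S pol ω.1 ω.2 t)

theorem signalHistory_succ (S : LinSys n p) (pol : Policy n p 𝒜) (t : ℕ)
    (ω : 𝒜 × (ℕ → Vec S.r)) :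
    signalHistory S pol (t + 1) ω = historyStep S pol t (signalHistory S pol t ω, ω.2 t) := rfl

theorem measurable_toEuclideanLin {a b : ℕ} (M : Matrix (Fin a) (Fin b) ℝ) :
    Measurable (Matrix.toEuclideanLin M : Vec b → Vec a) :=
  (LinearMap.continuous_of_finiteDimensional _).measurable

theorem measurable_fin_snoc {α β : Type*} [MeasurableSpace α] [MeasurableSpace β] {t : ℕ}
    {f : α → Fin t → β} {g : α → β} (hf : Measurable f) (hg : Measurable g) :
    Measurable fun a => (Fin.snoc (α := fun _ => β) (f a) (g a) : Fin (t + 1) → β) := by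
  refine measurable_pi_iff.2 fun i => ?_
  induction i using Fin.lastCases with
  | last => simpa using hg
  | cast i => simpa using (measurable_pi_iff.1 hf i)

theorem measurable_historyStep (S : LinSys n p) (pol : Policy n p 𝒜) (t : ℕ) :
    Measurable (historyStep S pol t) := by
  have hu : Measurable fun z : (𝒜 × ((Fin (t + 1) → Vec n) × (Fin t → Vec p))) × Vec S.r =>
      pol.act t (z.1.2.1, z.1.2.2, z.1.1) := (pol.measurable_act t).comp (by fun_prop)
  refine Measurable.prodMk (by fun_prop) (Measurable.prodMk ?_ ?_)
  · refine measurable_fin_snoc (by fun_prop) (((?_ : Measurable _).add ?_).add ?_)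
    · exact (measurable_toEuclideanLin S.A).comp (by fun_prop)
    · exact (measurable_toEuclideanLin S.B).comp hu
    · exact (measurable_toEuclideanLin S.H).comp (by fun_prop)
  · exact measurable_fin_snoc (by fun_prop) hu

theorem measurable_signalHistory (S : LinSys n p) (pol : Policy n p 𝒜) (t : ℕ) :
    Measurable (signalHistory S pol t) := by
  induction t with
  | zero => exact Measurable.prodMk measurable_fst measurable_const
  | succ t ih =>
    exact (measurable_historyStep S pol t).comp (ih.prodMk (by fun_prop))

/-- Causality of the loop. It is what makes `w t` independent of the history up to time `t`. -/
theorem history_congr (S : LinSys n p) (pol : Policy n p 𝒜) (a : 𝒜) {t : ℕ}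
    {w w' : ℕ → Vec S.r} (h : ∀ i < t, w i = w' i) :
    history S pol a w t = history S pol a w' t := by
  induction t with
  | zero => rfl
  | succ t ih =>
    have h1 := signalHistory_succ S pol t (a, w)
    have h2 := signalHistory_succ S pol t (a, w')
    simp only [signalHistory] at h1 h2
    rw [ih fun i hi => h i (by omega), h t (by omega), ← h2] at h1
    exact congrArg Prod.snd h1

/-- The joint law of the auxiliary signal and of the history up to time `t`. -/
noncomputable def historyLaw (S : LinSys n p) (pol : Policy n p 𝒜) (ν : Measure 𝒜) (t : ℕ) :
    Measure (𝒜 × ((Fin (t + 1) → Vec n) × (Fin t → Vec p))) :=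
  (ν.prod (Measure.infinitePi fun _ : ℕ => stdGaussian (Vec S.r))).map (signalHistory S pol t)

variable (S : LinSys n p) (pol : Policy n p 𝒜) (ν : Measure 𝒜) [IsProbabilityMeasure ν]

instance (t : ℕ) : IsProbabilityMeasure (historyLaw S pol ν t) :=
  Measure.isProbabilityMeasure_map (measurable_signalHistory S pol t).aemeasurable

theorem infinitePi_map_restrict_prod_eval {E : Type*} [MeasurableSpace E] (γ : Measure E)
    [IsProbabilityMeasure γ] (t : ℕ) :
    (Measure.infinitePi fun _ : ℕ => γ).map
        (fun w => (fun i : Finset.range t => w i, w t)) =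
      ((Measure.infinitePi fun _ : ℕ => γ).map (fun w => fun i : Finset.range t => w i)).prod γ := by
  have hind : iIndepFun (fun (i : ℕ) (w : ℕ → E) => w i) (Measure.infinitePi fun _ : ℕ => γ) :=
    iIndepFun_infinitePi (P := fun _ : ℕ => γ) (X := fun _ x => x) fun _ => measurable_id
  have h := hind.indepFun_finset (Finset.range t) {t} (by simp) (fun i => by fun_prop)
  have h' : IndepFun (fun (w : ℕ → E) (i : Finset.range t) => w i) (fun w => w t)
      (Measure.infinitePi fun _ : ℕ => γ) :=
    h.comp (φ := id) (ψ := fun x : (({t} : Finset ℕ) → E) => x ⟨t, by simp⟩) measurable_id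
      (measurable_pi_apply _)
  rw [h'.map_prod_eq_prod_map_map (Measurable.aemeasurable (by fun_prop))
    (Measurable.aemeasurable (by fun_prop))]
  congr 1
  exact Measure.infinitePi_map_eval _ t

theorem historyLaw_prod (t : ℕ) :
    (historyLaw S pol ν t).prod (stdGaussian (Vec S.r)) =
      (ν.prod (Measure.infinitePi fun _ : ℕ => stdGaussian (Vec S.r))).map
        (fun ω => (signalHistory S pol t ω, ω.2 t)) := by
  set γ := stdGaussian (Vec S.r)
  set P := Measure.infinitePi fun _ : ℕ => γ
  let R : (ℕ → Vec S.r) → (Finset.range t → Vec S.r) := fun w i => w i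
  have hR : Measurable R := by fun_prop
  -- Padding the first `t` noise vectors with zeros loses nothing, by causality, and exhibits the
  -- history as a function of finitely many of them.
  let X : (Finset.range t → Vec S.r) → (ℕ → Vec S.r) :=
    fun v i => if h : i < t then v ⟨i, Finset.mem_range.2 h⟩ else 0
  have hX : Measurable X := by
    refine measurable_pi_iff.2 fun i => ?_
    by_cases h : i < t
    · simp only [X, h, dif_pos]; fun_prop
    · simp only [X, h, dif_neg, not_false_eq_true]; fun_prop
  let F : 𝒜 × (Finset.range t → Vec S.r) → _ := fun z => signalHistory S pol t (z.1, X z.2)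
  have hF : Measurable F := (measurable_signalHistory S pol t).comp (by fun_prop)
  have hFR : ∀ ω, F (ω.1, R ω.2) = signalHistory S pol t ω := fun ω => by
    simp only [F, signalHistory]
    rw [history_congr S pol ω.1 (w := X (R ω.2)) (w' := ω.2)]
    intro i hi
    simp [X, R, hi]
  have hprob : IsProbabilityMeasure (P.map R) := Measure.isProbabilityMeasure_map hR.aemeasurable
  have h1 : historyLaw S pol ν t = (ν.prod (P.map R)).map F := by
    have : ν.prod (P.map R) = (ν.prod P).map (Prod.map id R) := by
      rw [← Measure.map_prod_map ν P measurable_id hR, Measure.map_id]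
    rw [this, Measure.map_map hF (by fun_prop)]
    exact congrArg (fun f => Measure.map f (ν.prod P)) (funext fun ω => (hFR ω).symm)
  have h2 : ν.prod ((P.map R).prod γ) = (ν.prod P).map (Prod.map id fun w => (R w, w t)) := by
    rw [← infinitePi_map_restrict_prod_eval γ t, ← Measure.map_prod_map ν P measurable_id
      (by fun_prop), Measure.map_id]
  calc (historyLaw S pol ν t).prod γ = ((ν.prod (P.map R)).prod γ).map (Prod.map F id) := by
        rw [h1, ← Measure.map_prod_map _ _ hF measurable_id, Measure.map_id]
    _ = ((ν.prod ((P.map R).prod γ)).map MeasurableEquiv.prodAssoc.symm).map (Prod.map F id) := by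
        rw [← Measure.prodAssoc_prod, Measure.map_map (f := MeasurableEquiv.prodAssoc)
          (by fun_prop) (by fun_prop), MeasurableEquiv.symm_comp_self, Measure.map_id]
    _ = _ := by
        rw [h2, Measure.map_map (by fun_prop) (by fun_prop), Measure.map_map (by fun_prop)
          (by fun_prop)]
        exact congrArg (fun f => Measure.map f (ν.prod P))
          (funext fun ω => Prod.ext (hFR ω) rfl)

/-- With the auxiliary signal included, histories form a Markov chain driven by fresh noise, so
relative entropy can be accumulated one step at a time. -/
theorem historyLaw_succ (t : ℕ) :
    historyLaw S pol ν (t + 1) =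
      ((historyLaw S pol ν t).prod (stdGaussian (Vec S.r))).map (historyStep S pol t) := by
  rw [historyLaw_prod, Measure.map_map (measurable_historyStep S pol t)
    ((measurable_signalHistory S pol t).prodMk (by fun_prop))]
  rfl

end HistoryLaw

/-! ### Relative entropy of history laws in variational form -/

section Variational

variable {n p : ℕ} {𝒜 : Type*} [MeasurableSpace 𝒜]

/-- Averaging out one noise vector by `log ∫ exp` keeps test functions bounded by the same constant,
so the induction over time stays within bounded functions. -/
theorem abs_log_integral_exp_le {Ω : Type*} [MeasurableSpace Ω] (P : Measure Ω)
    [IsProbabilityMeasure P] {f : Ω → ℝ} (hf : Measurable f) {C : ℝ} (hC : ∀ x, |f x| ≤ C) :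
    0 < ∫ x, Real.exp (f x) ∂P ∧ |Real.log (∫ x, Real.exp (f x) ∂P)| ≤ C := by
  have hint : Integrable (fun x => Real.exp (f x)) P :=
    integrable_of_bounded (C := Real.exp C) (Real.measurable_exp.comp hf) fun x => by
      rw [Real.abs_exp]; exact Real.exp_le_exp.2 (abs_le.1 (hC x)).2
  have hlow : Real.exp (-C) ≤ ∫ x, Real.exp (f x) ∂P := by
    simpa using integral_mono (integrable_const (μ := P) (Real.exp (-C))) hint
      fun x => Real.exp_le_exp.2 (abs_le.1 (hC x)).1
  have hup : ∫ x, Real.exp (f x) ∂P ≤ Real.exp C := by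
    simpa using integral_mono hint (integrable_const (μ := P) (Real.exp C))
      fun x => Real.exp_le_exp.2 (abs_le.1 (hC x)).2
  have hpos := (Real.exp_pos _).trans_le hlow
  refine ⟨hpos, abs_le.2 ⟨?_, ?_⟩⟩
  · simpa using Real.log_le_log (Real.exp_pos _) hlow
  · simpa using Real.log_le_log hpos hup

theorem integral_le_log_integral_exp {Ω : Type*} [MeasurableSpace Ω] (P : Measure Ω)
    [IsProbabilityMeasure P] {f : Ω → ℝ} (hf : Measurable f) {C : ℝ} (hC : ∀ x, |f x| ≤ C) :
    ∫ x, f x ∂P ≤ Real.log (∫ x, Real.exp (f x) ∂P) := by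
  have hint : Integrable (fun x => Real.exp (f x)) P :=
    integrable_of_bounded (C := Real.exp C) (Real.measurable_exp.comp hf) fun x => by
      rw [Real.abs_exp]; exact Real.exp_le_exp.2 (abs_le.1 (hC x)).2
  have hJ := convexOn_exp.map_integral_le (μ := P) Real.continuous_exp.continuousOn isClosed_univ
    (.of_forall fun _ => Set.mem_univ _) (integrable_of_bounded hf hC) hint
  simpa using Real.log_le_log (Real.exp_pos _) hJ

/-- If the closed loop of `(A', B', H)` is that of `(A, B, H)` with the noise shifted by an
adapted signal `v`, then the relative entropy between the two history laws is at most half the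
energy of `v` (stated in variational form). -/
theorem integral_historyLaw_le_log_integral_exp {A A' : Matrix (Fin n) (Fin n) ℝ}
    {B B' : Matrix (Fin n) (Fin p) ℝ} {H : Matrix (Fin n) (Fin 1) ℝ}
    (pol : Policy n p 𝒜) (ν : Measure 𝒜) [IsProbabilityMeasure ν]
    (v : (t : ℕ) → 𝒜 × ((Fin (t + 1) → Vec n) × (Fin t → Vec p)) → Vec 1)
    (hv : ∀ t, Measurable (v t))
    (hstep : ∀ t z w, historyStep ⟨1, A', B', H⟩ pol t (z, w) =
      historyStep ⟨1, A, B, H⟩ pol t (z, w + v t z))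
    (t : ℕ) (hint : ∀ i < t, Integrable (fun z => ‖v i z‖ ^ 2) (historyLaw ⟨1, A', B', H⟩ pol ν i))
    {f : 𝒜 × ((Fin (t + 1) → Vec n) × (Fin t → Vec p)) → ℝ} (hf : Measurable f) {C : ℝ}
    (hC : ∀ x, |f x| ≤ C) :
    ∫ z, f z ∂(historyLaw ⟨1, A', B', H⟩ pol ν t) ≤
      Real.log (∫ z, Real.exp (f z) ∂(historyLaw ⟨1, A, B, H⟩ pol ν t)) +
        (∑ i ∈ Finset.range t, ∫ z, ‖v i z‖ ^ 2 ∂(historyLaw ⟨1, A', B', H⟩ pol ν i)) / 2 := by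
  induction t with
  | zero =>
    have h0 : historyLaw ⟨1, A', B', H⟩ pol ν 0 = historyLaw ⟨1, A, B, H⟩ pol ν 0 := rfl
    simpa [h0] using integral_le_log_integral_exp (historyLaw ⟨1, A, B, H⟩ pol ν 0) hf hC
  | succ t ih =>
    set S : LinSys n p := ⟨1, A, B, H⟩
    set S' : LinSys n p := ⟨1, A', B', H⟩
    set γ : Measure (Vec 1) := stdGaussian (Vec 1)
    have hm := measurable_historyStep S pol t
    have hm' := measurable_historyStep S' pol t
    let F : (𝒜 × ((Fin (t + 1) → Vec n) × (Fin t → Vec p))) → Vec 1 → ℝ :=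
      fun z w => f (historyStep S pol t (z, w))
    have hF : Measurable (Function.uncurry F) := hf.comp hm
    have hFz : ∀ z, Measurable (F z) := fun z => hF.comp (measurable_const.prodMk measurable_id)
    have hFC : ∀ z w, |F z w| ≤ C := fun z w => hC _
    -- The induction hypothesis is applied to this function. Its exponential integrates the last
    -- noise vector out of `exp f`, so the logarithmic term at time `t` is the one at time `t + 1`.
    let g : (𝒜 × ((Fin (t + 1) → Vec n) × (Fin t → Vec p))) → ℝ :=
      fun z => Real.log (∫ w, Real.exp (F z w) ∂γ)
    have hg : Measurable g := by
      refine Real.measurable_log.comp (StronglyMeasurable.measurable ?_)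
      exact StronglyMeasurable.integral_prod_right
        (f := fun z w => Real.exp (F z w)) (Real.measurable_exp.comp hF).stronglyMeasurable
    have hgC : ∀ z, |g z| ≤ C := fun z => (abs_log_integral_exp_le γ (hFz z) (hFC z)).2
    have hexpg : ∀ z, Real.exp (g z) = ∫ w, Real.exp (F z w) ∂γ := fun z =>
      Real.exp_log (abs_log_integral_exp_le γ (hFz z) (hFC z)).1
    have hvi := hint t (by omega)
    have hint' : ∫ z, f z ∂(historyLaw S' pol ν (t + 1)) =
        ∫ z, ∫ w, F z (w + v t z) ∂γ ∂(historyLaw S' pol ν t) := by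
      rw [historyLaw_succ, integral_map hm'.aemeasurable hf.aestronglyMeasurable,
        integral_prod _ (integrable_of_bounded (f := fun z => f (historyStep S' pol t z))
          (hf.comp hm') fun x => hC _)]
      exact integral_congr_ae (.of_forall fun z => integral_congr_ae
        (.of_forall fun w => congrArg f (hstep t z w)))
    have hexp : ∫ z, Real.exp (f z) ∂(historyLaw S pol ν (t + 1)) =
        ∫ z, Real.exp (g z) ∂(historyLaw S pol ν t) := by
      have hme := Real.measurable_exp.comp hf
      rw [historyLaw_succ, integral_map (f := fun z => Real.exp (f z)) hm.aemeasurable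
        hme.aestronglyMeasurable,
        integral_prod _ (integrable_of_bounded (f := fun z => Real.exp (f (historyStep S pol t z)))
          (C := Real.exp C) (hme.comp hm) fun x => by
          rw [Real.abs_exp]
          exact Real.exp_le_exp.2 (abs_le.1 (hC _)).2)]
      simp only [hexpg]
      rfl
    -- Given the history `z`, the shift `v t z` is a constant, so the inequality for a fixed shift
    -- applies pointwise in `z`.
    have hone : ∀ z, ∫ w, F z (w + v t z) ∂γ ≤ g z + ‖v t z‖ ^ 2 / 2 := fun z =>
      integral_add_le_log_integral_exp_stdGaussian (hFz z) (hFC z) (v t z)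
    have hL : Integrable (fun z => ∫ w, F z (w + v t z) ∂γ) (historyLaw S' pol ν t) := by
      refine integrable_of_bounded (C := C) (StronglyMeasurable.measurable ?_) fun z => ?_
      · refine StronglyMeasurable.integral_prod_right (f := fun z w => F z (w + v t z)) ?_
        refine (hF.comp (Measurable.prodMk measurable_fst
          (measurable_snd.add ((hv t).comp measurable_fst)))).stronglyMeasurable
      · simpa using norm_integral_le_of_norm_le_const (μ := γ) (f := fun w => F z (w + v t z))
          (.of_forall fun w => hFC z _)
    have hmono := integral_mono hL ((integrable_of_bounded hg hgC).add (hvi.div_const 2)) hone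
    have hsplit : ∫ z, (g z + ‖v t z‖ ^ 2 / 2) ∂(historyLaw S' pol ν t) =
        ∫ z, g z ∂(historyLaw S' pol ν t) + (∫ z, ‖v t z‖ ^ 2 ∂(historyLaw S' pol ν t)) / 2 := by
      rw [integral_add (integrable_of_bounded hg hgC) (hvi.div_const 2), integral_div]
    have hIH := ih (fun i hi => hint i (by omega)) hg hgC
    rw [hint', hexp, Finset.sum_range_succ]
    simp only [Pi.add_apply] at hmono
    linarith

end Variational

/-! ### Lower bound on relative entropy from a test -/

/-- Testing two hypotheses with error probabilities at most `δ < 1/2` costs relative entropy at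
least `log (1 / (3 δ))`. -/
theorem log_le_of_forall_variational {δ D : ℝ} (hδ₀ : 0 ≤ δ) (hδ₁ : δ < 1 / 2)
    (h : ∀ c : ℝ, 0 ≤ c → c * (1 - δ) ≤ Real.log (1 + (Real.exp c - 1) * δ) + D) :
    0 < δ ∧ Real.log (1 / (3 * δ)) ≤ D := by
  have hpos : 0 < δ := by
    rcases hδ₀.eq_or_lt with rfl | h0
    · have := h (|D| + 1) (by positivity)
      simp only [sub_zero, mul_one, mul_zero, add_zero, Real.log_one, zero_add] at this
      linarith [le_abs_self D]
    · exact h0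
  refine ⟨hpos, ?_⟩
  have h1 : 0 < 1 - δ := by linarith
  set L := Real.log ((1 - δ) / δ) with hL
  have hL0 : 0 ≤ L := Real.log_nonneg (by rw [le_div_iff₀ hpos]; linarith)
  -- The optimal exponent: the inequality becomes `(1 - 2 * δ) * L ≤ D`, whose left side is the
  -- relative entropy of Bernoulli laws with parameters `1 - δ` and `δ`.
  have hc := h (2 * L) (by positivity)
  have hexp : Real.exp (2 * L) = ((1 - δ) / δ) ^ 2 := by
    rw [two_mul, Real.exp_add, hL, Real.exp_log (by positivity), sq]
  have harg : 1 + (Real.exp (2 * L) - 1) * δ = (1 - δ) / δ := by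
    rw [hexp]; field_simp; ring
  rw [harg, ← hL] at hc
  have hLd : L = Real.log (1 - δ) - Real.log δ := Real.log_div h1.ne' hpos.ne'
  have hconc := strictConcaveOn_log_Ioi.concaveOn.2
  -- What remains is `2 δ log (1/δ) + (1 - 2δ) log (1/(1 - δ)) ≤ log 3`. By concavity the left side
  -- is at most `log (2 + (1 - 2δ)/(1 - δ))`, and the quotient is at most `1`.
  have hJ := hconc (Set.mem_Ioi.2 (one_div_pos.2 hpos)) (Set.mem_Ioi.2 (one_div_pos.2 h1))
    (show 0 ≤ 2 * δ by linarith) (show 0 ≤ 1 - 2 * δ by linarith) (by ring)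
  simp only [smul_eq_mul, one_div, Real.log_inv] at hJ
  have h3 : Real.log (2 * δ * δ⁻¹ + (1 - 2 * δ) * (1 - δ)⁻¹) ≤ Real.log 3 := by
    have hq : (1 - 2 * δ) * (1 - δ)⁻¹ ≤ 1 := by
      rw [← div_eq_mul_inv, div_le_one h1]; linarith
    have hq0 : 0 ≤ (1 - 2 * δ) * (1 - δ)⁻¹ := mul_nonneg (by linarith) (by positivity)
    refine Real.log_le_log ?_ ?_ <;> rw [mul_assoc, mul_inv_cancel₀ hpos.ne'] <;> linarith
  rw [one_div, Real.log_inv, Real.log_mul (by norm_num) hpos.ne']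
  rw [hLd] at hc
  nlinarith

/-! ### Spectral radius and determinants -/

section SpectralRadius

variable {n : ℕ}

theorem le_rho_of_det_eq_zero {A : Matrix (Fin n) (Fin n) ℝ} {x : ℝ}
    (h : (x • (1 : Matrix (Fin n) (Fin n) ℝ) - A).det = 0) : ‖x‖ₑ ≤ rho A := by
  have hmem : (x : ℂ) ∈ spectrum ℂ (A.map (algebraMap ℝ ℂ)) := by
    rw [spectrum.mem_iff, Matrix.isUnit_iff_isUnit_det]
    have : algebraMap ℂ (Matrix (Fin n) (Fin n) ℂ) x - A.map (algebraMap ℝ ℂ) =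
        (algebraMap ℝ ℂ).mapMatrix (x • (1 : Matrix (Fin n) (Fin n) ℝ) - A) := by
      ext i j
      by_cases hij : i = j <;> simp [hij, Matrix.algebraMap_matrix_apply]
    rw [this, ← RingHom.map_det, h]
    simp
  refine le_trans ?_ (le_iSup₂ (α := ℝ≥0∞) (x : ℂ) hmem)
  simp [enorm_eq_nnnorm]

/-- A real matrix with `det (1 - A) ≤ 0` is not Schur stable. -/
theorem one_le_rho_of_det_nonpos {A : Matrix (Fin n) (Fin n) ℝ}
    (h : (1 - A).det ≤ 0) : 1 ≤ rho A := by
  -- The determinant of `1 - s • A` goes from `1` at `s = 0` to a non-positive value at `s = 1`. A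
  -- zero `s` in between gives the real eigenvalue `1 / s ≥ 1`.
  have hcont : Continuous fun s : ℝ => (1 - s • A).det := by fun_prop
  obtain ⟨s, ⟨hs0, hs1⟩, hs⟩ := intermediate_value_Icc' zero_le_one hcont.continuousOn
    (show (0 : ℝ) ∈ Set.Icc _ _ by simpa using h)
  have hs' : s ≠ 0 := by rintro rfl; simp at hs
  have hdet : (s⁻¹ • (1 : Matrix (Fin n) (Fin n) ℝ) - A).det = 0 := by
    have : s⁻¹ • (1 : Matrix (Fin n) (Fin n) ℝ) - A = s⁻¹ • (1 - s • A) := by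
      rw [smul_sub, smul_smul, inv_mul_cancel₀ hs', one_smul]
    rw [this, Matrix.det_smul]
    simp only at hs
    rw [hs, mul_zero]
  refine le_trans ?_ (le_rho_of_det_eq_zero hdet)
  rw [← ofReal_norm, ← ENNReal.ofReal_one]
  refine ENNReal.ofReal_le_ofReal ?_
  rw [Real.norm_of_nonneg (by positivity)]
  exact (one_le_inv₀ (hs0.lt_of_ne' hs')).2 hs1

theorem rho_le_one {A : Matrix (Fin n) (Fin n) ℝ}
    (h : ∀ (l : ℂ) (v : Fin n → ℂ), A.map (algebraMap ℝ ℂ) *ᵥ v = l • v → v ≠ 0 → ‖l‖ ≤ 1) :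
    rho A ≤ 1 := by
  refine iSup₂_le fun l hl => ?_
  rw [← Matrix.spectrum_toLin', ← Module.End.hasEigenvalue_iff_mem_spectrum] at hl
  obtain ⟨v, hv⟩ := hl.exists_hasEigenvector
  have := h l v (by simpa using hv.apply_eq_smul) hv.2
  exact ENNReal.coe_le_one_iff.2 this

end SpectralRadius

/-! ### Norms and singular values from Gram matrices -/

theorem l2_opNorm_le_of_mul_transpose_eq_diagonal {a b : ℕ} {X : Matrix (Fin a) (Fin b) ℝ}
    {d : Fin a → ℝ} (h : X * Xᵀ = Matrix.diagonal d) {C : ℝ} (hC : 0 ≤ C)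
    (hd : ∀ i, |d i| ≤ C ^ 2) : ‖X‖ ≤ C := by
  have h1 := Matrix.l2_opNorm_conjTranspose_mul_self Xᴴ
  rw [Matrix.l2_opNorm_conjTranspose, Matrix.conjTranspose_conjTranspose,
    Matrix.conjTranspose_eq_transpose_of_trivial, h, Matrix.l2_opNorm_diagonal] at h1
  have h2 : ‖d‖ ≤ C ^ 2 := (pi_norm_le_iff_of_nonneg (by positivity)).2 hd
  exact abs_le_of_sq_le_sq' (by nlinarith) hC |>.2

theorem finrank_range_toEuclideanLin {a b : ℕ} (X : Matrix (Fin a) (Fin b) ℝ) :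
    Module.finrank ℝ (Matrix.toEuclideanLin X).range = X.rank := by
  change Module.finrank ℝ (Matrix.toLpLin 2 2 X).range = X.rank
  rw [Matrix.toLpLin_eq_toLin, ← Matrix.rank_eq_finrank_range_toLin]

/-- `T` maps an eigenvector of `T* T` for `σ_k ^ 2` to an eigenvector of `T T* = μ ^ 2` with the
same eigenvalue. Full row rank gives `σ_k > 0`, so the image is non-zero and `σ_k = μ`. -/
theorem le_sigmaVal_of_mul_transpose_eq {a b k : ℕ} {X : Matrix (Fin a) (Fin b) ℝ} {μ : ℝ}
    (hμ : 0 < μ) (h : X * Xᵀ = μ ^ 2 • (1 : Matrix (Fin a) (Fin a) ℝ)) (hk : k = a) (ha : 1 ≤ k) :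
    μ ≤ sigmaVal k X := by
  subst hk
  have hrank : X.rank = k := by
    rw [← Matrix.rank_self_mul_transpose, h, Matrix.rank_smul_of_mem_nonZeroDivisors]
    · simp
    · exact mem_nonZeroDivisors_of_ne_zero (by positivity)
  set T := Matrix.toEuclideanLin X with hT
  have hfr : Module.finrank ℝ T.range = k := by
    refine Eq.trans ?_ hrank
    exact finrank_range_toEuclideanLin X
  have hpos : 0 < T.singularValues (k - 1) :=
    T.singularValues_pos_iff_lt_finrank_range.2 (by omega)
  have hab : k - 1 < Module.finrank ℝ (EuclideanSpace ℝ (Fin b)) := by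
    by_contra hlt
    rw [T.singularValues_of_finrank_le (not_lt.1 hlt)] at hpos
    exact hpos.false
  obtain ⟨v, hv⟩ := (T.hasEigenvalue_adjoint_comp_self_sq_singularValues hab).exists_hasEigenvector
  have hTT : ∀ w, T (LinearMap.adjoint T w) = μ ^ 2 • w := fun w => by
    have hadj : LinearMap.adjoint T = Matrix.toEuclideanLin Xᵀ := by
      rw [hT, ← Matrix.conjTranspose_eq_transpose_of_trivial,
        Matrix.toEuclideanLin_conjTranspose_eq_adjoint]
    rw [hadj, hT]
    ext i
    simp [Matrix.toLpLin_apply, Matrix.mulVec_mulVec, h, Matrix.smul_mulVec]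
  have hev : LinearMap.adjoint T (T v) = T.singularValues (k - 1) ^ 2 • v := hv.apply_eq_smul
  have h1 := congrArg T hev
  rw [hTT, map_smul] at h1
  have hTv : T v ≠ 0 := fun h0 => by
    rw [h0, map_zero] at hev
    exact hv.2 ((smul_eq_zero.1 hev.symm).resolve_left (by positivity))
  have h2 : μ ^ 2 = T.singularValues (k - 1) ^ 2 := smul_left_injective ℝ hTv h1
  exact (abs_le_of_sq_le_sq' h2.le hpos.le).2

theorem le_of_sigmaVal_pos {a b k : ℕ} {X : Matrix (Fin a) (Fin b) ℝ} (h : 0 < sigmaVal k X) :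
    k ≤ a ∧ k ≤ b := by
  have h1 := (LinearMap.singularValues_pos_iff_lt_finrank_range _).1 h
  rw [finrank_range_toEuclideanLin] at h1
  have h2 := X.rank_le_height
  have h3 := X.rank_le_width
  omega

/-! ### The chain systems -/

section Chain

/-- The coordinates of `ℝ^n` are arranged in `κ` blocks of non-increasing sizes `q 0 = p, q 1, …`:
coordinate `i` is the one at position `pos i` of block `blk i`. -/
structure StairShape {n : ℕ} (p κ : ℕ) (q : ℕ → ℕ) (blk pos : Fin n → ℕ) : Prop where
  inj : ∀ i j, blk i = blk j → pos i = pos j → i = j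
  surj : ∀ b a, a < q b → ∃ i, blk i = b ∧ pos i = a
  pos_lt : ∀ i, pos i < q (blk i)
  blk_lt : ∀ i, blk i < κ
  q_zero : q 0 = p
  anti : ∀ b, q (b + 1) ≤ q b

variable {n p κ : ℕ} {q : ℕ → ℕ} {blk pos : Fin n → ℕ}

/-- The signs in the chain system: only the coordinate `y` may have sign `ε ≠ 1`. -/
def chainSign (y : Fin n) (ε : ℝ) (i : Fin n) : ℝ := if i = y then ε else 1

variable (blk pos) in
/-- The state matrix of the chain system: each coordinate is driven, with gain `±μ`, by the
coordinate at the same position of the previous block; the coordinate `y` also integrates. -/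
def chainA (y : Fin n) (μ ε : ℝ) : Matrix (Fin n) (Fin n) ℝ :=
  Matrix.of fun i j => (if i = y then if j = y then 1 else 0 else 0) +
    μ * chainSign y ε i * if blk i = blk j + 1 ∧ pos i = pos j then 1 else 0

variable (p blk pos) in
/-- The input matrix of the chain system: the inputs drive the first block with gain `±μ`. -/
def chainB (y : Fin n) (μ ε : ℝ) : Matrix (Fin n) (Fin p) ℝ :=
  Matrix.of fun i a => μ * chainSign y ε i * if blk i = 0 ∧ pos i = a then 1 else 0

/-- The noise of the chain system enters at the coordinate `y` only. -/
def chainH (y : Fin n) : Matrix (Fin n) (Fin 1) ℝ :=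
  Matrix.of fun i _ => if i = y then 1 else 0

variable (p blk pos) in
/-- The chain system. -/
def chainSys (y : Fin n) (μ ε : ℝ) : LinSys n p :=
  ⟨1, chainA blk pos y μ ε, chainB p blk pos y μ ε, chainH y⟩

theorem chainSign_sq (y : Fin n) {ε : ℝ} (hε : ε ^ 2 = 1) (i : Fin n) :
    chainSign y ε i ^ 2 = 1 := by
  unfold chainSign; split_ifs <;> simp [hε]

theorem StairShape.exists_pred (h : StairShape p κ q blk pos) {i : Fin n} (hi : blk i ≠ 0) :
    ∃ j, blk i = blk j + 1 ∧ pos i = pos j := by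
  obtain ⟨b, hb⟩ := Nat.exists_eq_succ_of_ne_zero hi
  obtain ⟨j, hj, hj'⟩ := h.surj b (pos i) ((h.pos_lt i).trans_le (hb ▸ h.anti b))
  exact ⟨j, by omega, hj'.symm⟩

theorem StairShape.pos_lt_p (h : StairShape p κ q blk pos) (i : Fin n) : pos i < p := by
  have : ∀ b, q b ≤ q 0 := fun b => antitone_nat_of_succ_le h.anti (Nat.zero_le b)
  exact h.q_zero ▸ (h.pos_lt i).trans_le (this _)

theorem StairShape.sum_pred_of_zero {R : Type*} [AddCommMonoid R]
    {i : Fin n} (hi : blk i = 0) (f : Fin n → R) :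
    ∑ j, (if blk i = blk j + 1 ∧ pos i = pos j then f j else 0) = 0 :=
  Finset.sum_eq_zero fun j _ => if_neg fun hj => by omega

theorem StairShape.sum_pred (h : StairShape p κ q blk pos) {R : Type*} [AddCommMonoid R]
    {i j : Fin n} (hij : blk i = blk j + 1) (hij' : pos i = pos j) (f : Fin n → R) :
    ∑ k, (if blk i = blk k + 1 ∧ pos i = pos k then f k else 0) = f j := by
  rw [Finset.sum_eq_single j (fun k _ hk => if_neg fun hk' => hk (h.inj k j (by omega) (by omega)))
    (by simp), if_pos ⟨hij, hij'⟩]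

/-- The ring homomorphism lets one formula serve both complex eigenvectors and real matrix products.
-/
theorem sum_chainA_mul {R : Type*} [CommRing R] (φ : ℝ →+* R) (y : Fin n) (μ ε : ℝ) (i : Fin n)
    (f : Fin n → R) :
    ∑ j, φ (chainA blk pos y μ ε i j) * f j = (if i = y then f y else 0) +
      φ (μ * chainSign y ε i) * ∑ j, (if blk i = blk j + 1 ∧ pos i = pos j then f j else 0) := by
  rw [Finset.mul_sum]
  simp only [chainA, Matrix.of_apply, map_add, add_mul, Finset.sum_add_distrib]
  congr 1
  · split_ifs with h
    · rw [Finset.sum_eq_single y] <;> simp +contextual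
    · simp
  · refine Finset.sum_congr rfl fun j _ => ?_
    split_ifs <;> simp

/-- Ordered by blocks, the matrix is triangular with diagonal entries `0`, except for `1` at `y`. An
eigenvector with `‖l‖ > 1` therefore vanishes block after block. -/
theorem rho_chainA_le_one (y : Fin n) (μ ε : ℝ) :
    rho (chainA blk pos y μ ε) ≤ 1 := by
  refine rho_le_one fun l v hv hv0 => ?_
  by_contra! hl
  refine hv0 ?_
  have key : ∀ b i, blk i = b → v i = 0 := by
    intro b
    induction b using Nat.strong_induction_on with
    | _ b ih =>
      intro i hi
      have h1 : ∑ j, (algebraMap ℝ ℂ) (chainA blk pos y μ ε i j) * v j = l * v i := by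
        simpa [Matrix.mulVec, dotProduct] using congrFun hv i
      have h2 : ∑ j, (if blk i = blk j + 1 ∧ pos i = pos j then v j else 0) = 0 :=
        Finset.sum_eq_zero fun j _ => by
          split_ifs with hj
          · exact ih (blk j) (by omega) j rfl
          · rfl
      rw [sum_chainA_mul, h2, mul_zero, add_zero] at h1
      have hl0 : l ≠ 0 := by rintro rfl; simp at hl; linarith
      have hl1 : l ≠ 1 := by rintro rfl; simp at hl
      split_ifs at h1 with hiy
      · subst hiy
        have : (l - 1) * v i = 0 := by linear_combination -h1
        exact (mul_eq_zero.1 this).resolve_left (sub_ne_zero.2 hl1)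
      · exact (mul_eq_zero.1 h1.symm).resolve_left hl0
  exact funext fun i => key _ i rfl

/-- The rows are orthogonal: different coordinates have different predecessors, and since `y` lies
in the last block it precedes nothing, so its column holds only the integrator. The largest possible
entry is `1 + μ ^ 2`, at `y` when `κ ≥ 2`, hence the condition on `M`. -/
theorem StairShape.chainA_mul_transpose (h : StairShape p κ q blk pos) {y : Fin n}
    (hy : blk y + 1 = κ) (μ : ℝ) {ε : ℝ} (hε : ε ^ 2 = 1) :
    chainA blk pos y μ ε * (chainA blk pos y μ ε)ᵀ =
      Matrix.diagonal fun i => (if i = y then 1 else 0) + if blk i = 0 then 0 else μ ^ 2 := by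
  have hcol : ∀ k, chainA blk pos y μ ε k y = if k = y then 1 else 0 := fun k => by
    have : ¬ (blk k = blk y + 1) := fun hk => by have := h.blk_lt k; omega
    simp [chainA, this]
  ext i k
  rw [Matrix.mul_apply]
  simp only [Matrix.transpose_apply]
  have := sum_chainA_mul (blk := blk) (pos := pos) (RingHom.id ℝ) y μ ε i
    (fun j => chainA blk pos y μ ε k j)
  simp only [RingHom.id_apply] at this
  rw [this, hcol]
  by_cases hi : blk i = 0
  · rw [sum_pred_of_zero hi]
    by_cases hik : i = k
    · subst hik; simp [hi]
    · rw [Matrix.diagonal_apply_ne _ hik]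
      split_ifs with h1 h2 <;> simp
      exact hik (h1.trans h2.symm)
  · obtain ⟨j, hj, hj'⟩ := h.exists_pred hi
    have hjy : j ≠ y := by rintro rfl; have := h.blk_lt i; omega
    rw [h.sum_pred hj hj']
    by_cases hik : i = k
    · subst hik
      have hs := chainSign_sq y hε i
      simp only [Matrix.diagonal_apply_eq, chainA, Matrix.of_apply, hj, hj', hjy]
      by_cases hiy : i = y
      · rw [hiy] at hs
        simp [hiy]
        linear_combination μ ^ 2 * hs
      · simp [hiy]
        linear_combination μ ^ 2 * hs
    · rw [Matrix.diagonal_apply_ne _ hik]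
      have hkj : ¬ (blk k = blk j + 1 ∧ pos k = pos j) := fun hk =>
        hik (h.inj i k (by omega) (by omega))
      have hiky : ¬ (i = y ∧ k = y) := fun hk => hik (hk.1.trans hk.2.symm)
      simp only [chainA, Matrix.of_apply, hkj, hjy]
      split_ifs <;> simp_all

theorem StairShape.norm_chainA_le (h : StairShape p κ q blk pos) {y : Fin n}
    (hy : blk y + 1 = κ) {μ ε M : ℝ} (hε : ε ^ 2 = 1) (hM : 1 ≤ M)
    (hMκ : 2 ≤ κ → √(1 + μ ^ 2) ≤ M) : ‖chainA blk pos y μ ε‖ ≤ M := by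
  refine l2_opNorm_le_of_mul_transpose_eq_diagonal (h.chainA_mul_transpose hy μ hε)
    (by linarith) fun i => ?_
  have hM1 : 1 ≤ M ^ 2 := by nlinarith
  by_cases hi : blk i = 0
  · simp only [hi, if_true, add_zero]
    split_ifs
    · rwa [abs_one]
    · rw [abs_zero]; linarith
  · have hκ : 2 ≤ κ := by have := h.blk_lt i; omega
    have hMμ : 1 + μ ^ 2 ≤ M ^ 2 := by
      rw [← Real.sqrt_le_left (by linarith)]; exact hMκ hκ
    rw [abs_of_nonneg (by split_ifs <;> positivity)]
    split_ifs <;> nlinarith [sq_nonneg μ]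

theorem StairShape.chainB_transpose_mul (h : StairShape p κ q blk pos) (y : Fin n)
    (μ : ℝ) {ε : ℝ} (hε : ε ^ 2 = 1) :
    (chainB p blk pos y μ ε)ᵀ * chainB p blk pos y μ ε = μ ^ 2 • 1 := by
  ext a b
  obtain ⟨i, hi, hi'⟩ := h.surj 0 a (h.q_zero ▸ a.2)
  have hs := chainSign_sq y hε i
  rw [Matrix.mul_apply, Finset.sum_eq_single i]
  · by_cases hab : a = b
    · subst hab
      simp [chainB, hi, hi']
      linear_combination μ ^ 2 * hs
    · have : (a : ℕ) ≠ b := fun h => hab (Fin.ext h)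
      simp [chainB, hi, hi', hab, this]
  · intro j _ hj
    have : ¬ (blk j = 0 ∧ pos j = a) := fun hk => hj (h.inj j i (by omega) (by omega))
    simp [chainB, this]
  · simp

theorem chainH_transpose_mul (y : Fin n) : (chainH y)ᵀ * chainH y = 1 := by
  ext a b
  rw [Subsingleton.elim a b, Matrix.mul_apply, Finset.sum_eq_single y] <;>
    simp +contextual [chainH]

theorem rank_eq_of_transpose_mul {a b : ℕ} {X : Matrix (Fin a) (Fin b) ℝ} {c : ℝ} (hc : c ≠ 0)
    (h : Xᵀ * X = c • 1) : X.rank = b := by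
  rw [← Matrix.rank_transpose_mul_self, h,
    Matrix.rank_smul_of_mem_nonZeroDivisors _ (mem_nonZeroDivisors_of_ne_zero hc)]
  simp

theorem norm_le_of_transpose_mul {a b : ℕ} {X : Matrix (Fin a) (Fin b) ℝ} {c C : ℝ} (hC : 0 ≤ C)
    (h : Xᵀ * X = c • 1) (hc : |c| ≤ C ^ 2) : ‖X‖ ≤ C := by
  rw [← Matrix.l2_opNorm_conjTranspose, Matrix.conjTranspose_eq_transpose_of_trivial]
  refine l2_opNorm_le_of_mul_transpose_eq_diagonal (d := fun _ => c) ?_ hC fun _ => hc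
  rw [Matrix.transpose_transpose, h, Matrix.smul_one_eq_diagonal]

/-- An impulse moves one block per step. It reaches the last block only at `t = κ - 1`, so in this
range the integrator has not yet acted. -/
theorem StairShape.chainA_pow_mul_chainB (h : StairShape p κ q blk pos) {y : Fin n}
    (hy : blk y + 1 = κ) (μ ε : ℝ) {t : ℕ} (ht : t < κ) (i : Fin n) (a : Fin p) :
    (chainA blk pos y μ ε ^ t * chainB p blk pos y μ ε) i a =
      if blk i = t ∧ pos i = a then chainSign y ε i * μ ^ (t + 1) else 0 := by
  induction t generalizing i with
  | zero =>
    rw [pow_zero, Matrix.one_mul, chainB, Matrix.of_apply]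
    split_ifs <;> simp [mul_comm]
  | succ t ih =>
    rw [pow_succ', Matrix.mul_assoc, Matrix.mul_apply]
    have hs := sum_chainA_mul (blk := blk) (pos := pos) (RingHom.id ℝ) y μ ε i
      (fun j => (chainA blk pos y μ ε ^ t * chainB p blk pos y μ ε) j a)
    simp only [RingHom.id_apply] at hs
    rw [hs]
    simp only [ih (by omega)]
    have hyt : blk y ≠ t := by omega
    by_cases hi : blk i = 0
    · rw [sum_pred_of_zero hi]
      simp [hyt, hi]
    · obtain ⟨j, hj, hj'⟩ := h.exists_pred hi
      have hjy : j ≠ y := by rintro rfl; have := h.blk_lt i; omega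
      rw [h.sum_pred hj hj']
      have hsj : chainSign y ε j = 1 := if_neg hjy
      rw [if_neg fun hh : blk y = t ∧ _ => hyt hh.1, ite_self, zero_add]
      by_cases hc : blk j = t ∧ pos j = a
      · rw [if_pos hc, if_pos ⟨by omega, by omega⟩, hsj]
        ring
      · rw [if_neg hc, if_neg fun hh => hc ⟨by omega, by omega⟩, mul_zero]

/-- Coordinate `i` is hit only by the column `(blk i, pos i)`, so the rows are orthogonal and the
Gram matrix is diagonal. Its non-zero entries are those of the blocks already reached. -/
theorem StairShape.rank_ctrbMatrix (h : StairShape p κ q blk pos) {y : Fin n}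
    (hy : blk y + 1 = κ) {μ ε : ℝ} (hμ : μ ≠ 0) (hε : ε ^ 2 = 1) {k : ℕ} (hk : k ≤ κ) :
    (ctrbMatrix (chainA blk pos y μ ε) (chainB p blk pos y μ ε) k).rank =
      (Finset.univ.filter fun i => blk i < k).card := by
  set C := ctrbMatrix (chainA blk pos y μ ε) (chainB p blk pos y μ ε) k with hC
  have hCe : ∀ i (ta : Fin k × Fin p), C i ta =
      if blk i = ta.1 ∧ pos i = ta.2 then chainSign y ε i * μ ^ ((ta.1 : ℕ) + 1) else 0 :=
    fun i ta => h.chainA_pow_mul_chainB hy μ ε (ta.1.2.trans_le hk) i ta.2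
  have hCC : C * Cᵀ =
      Matrix.diagonal fun i => if blk i < k then (μ ^ (blk i + 1)) ^ 2 else 0 := by
    ext i j
    rw [Matrix.mul_apply]
    by_cases hij : i = j
    · subst hij
      rw [Matrix.diagonal_apply_eq]
      split_ifs with hi
      · rw [Finset.sum_eq_single (⟨⟨blk i, hi⟩, ⟨pos i, h.pos_lt_p i⟩⟩ : Fin k × Fin p)]
        · simp only [Matrix.transpose_apply, hCe]
          simp
          linear_combination (μ ^ (blk i + 1)) ^ 2 * chainSign_sq y hε i
        · intro ta _ hta
          have : ¬ (blk i = ta.1 ∧ pos i = ta.2) := fun hh =>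
            hta (Prod.ext (Fin.ext hh.1.symm) (Fin.ext hh.2.symm))
          simp [hCe, this]
        · simp
      · refine Finset.sum_eq_zero fun ta _ => ?_
        have : ¬ (blk i = ta.1 ∧ pos i = ta.2) := fun hh => hi (hh.1 ▸ ta.1.2)
        simp [hCe, this]
    · rw [Matrix.diagonal_apply_ne _ hij]
      refine Finset.sum_eq_zero fun ta _ => ?_
      simp only [Matrix.transpose_apply, hCe]
      by_cases h1 : blk i = ta.1 ∧ pos i = ta.2
      · have : ¬ (blk j = ta.1 ∧ pos j = ta.2) := fun h2 => hij (h.inj i j (by omega) (by omega))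
        simp [this]
      · simp [h1]
  rw [← Matrix.rank_self_mul_transpose, hCC, Matrix.rank_diagonal, Fintype.card_subtype]
  congr 1
  ext i
  simp [hμ]

theorem StairShape.card_filter_blk (h : StairShape p κ q blk pos) (b : ℕ) :
    (Finset.univ.filter fun i => blk i = b).card = q b := by
  have : (Finset.univ.filter fun i => blk i = b).image pos = Finset.range (q b) := by
    ext a
    simp only [Finset.mem_image, Finset.mem_filter, Finset.mem_univ, true_and, Finset.mem_range]
    constructor
    · rintro ⟨i, rfl, rfl⟩; exact h.pos_lt i
    · exact h.surj b a
  rw [← Finset.card_range (q b), ← this, Finset.card_image_of_injOn]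
  intro i hi j hj hij
  simp only [Finset.coe_filter, Finset.mem_univ, true_and, Set.mem_ofPred_eq] at hi hj
  exact h.inj i j (by omega) hij

theorem StairShape.ctrbIndex_eq (h : StairShape p κ q blk pos) {y : Fin n}
    (hy : blk y + 1 = κ) {μ ε : ℝ} (hμ : μ ≠ 0) (hε : ε ^ 2 = 1) :
    ctrbIndex (chainA blk pos y μ ε) (chainB p blk pos y μ ε) = κ := by
  have hmem : κ ∈ {k : ℕ | 1 ≤ k ∧
      (ctrbMatrix (chainA blk pos y μ ε) (chainB p blk pos y μ ε) k).rank = n} := by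
    refine ⟨by omega, ?_⟩
    rw [h.rank_ctrbMatrix hy hμ hε le_rfl, Finset.filter_true_of_mem fun i _ => h.blk_lt i]
    simp
  refine le_antisymm (Nat.sInf_le hmem) (le_csInf ⟨κ, hmem⟩ fun k hk => ?_)
  by_contra hlt
  have h1 := hk.2
  rw [h.rank_ctrbMatrix hy hμ hε (by omega)] at h1
  have h2 := Finset.card_lt_univ_of_notMem (s := Finset.univ.filter fun i => blk i < k) (x := y)
    (by simp; omega)
  simp only [Fintype.card_fin] at h2
  omega

theorem StairShape.blockSize_eq (h : StairShape p κ q blk pos) {y : Fin n}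
    (hy : blk y + 1 = κ) {μ ε : ℝ} (hμ : μ ≠ 0) (hε : ε ^ 2 = 1) {b : ℕ} (hb : b < κ) :
    blockSize (chainA blk pos y μ ε) (chainB p blk pos y μ ε) b = q b := by
  rw [blockSize, h.rank_ctrbMatrix hy hμ hε hb, h.rank_ctrbMatrix hy hμ hε hb.le,
    ← h.card_filter_blk b]
  have : (Finset.univ.filter fun i => blk i < b + 1) =
      (Finset.univ.filter fun i => blk i < b).disjUnion (Finset.univ.filter fun i => blk i = b)
        (Finset.disjoint_filter.2 fun i _ h1 h2 => by omega) := by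
    ext i; simp; omega
  rw [this, Finset.card_disjUnion]
  omega

/-- The integrator cancels the diagonal entry of `1` in row `y`, so everything left in that row
carries the factor `ε`, which can be pulled out as a diagonal matrix for every `K`. -/
theorem det_one_sub_chain (y : Fin n) (μ ε : ℝ) (K : Matrix (Fin p) (Fin n) ℝ) :
    (1 - (chainA blk pos y μ ε + chainB p blk pos y μ ε * K)).det =
      ε * (1 - (chainA blk pos y μ 1 + chainB p blk pos y μ 1 * K)).det := by
  have : 1 - (chainA blk pos y μ ε + chainB p blk pos y μ ε * K) =
      Matrix.diagonal (chainSign y ε) *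
        (1 - (chainA blk pos y μ 1 + chainB p blk pos y μ 1 * K)) := by
    ext i j
    have hA : (1 : Matrix (Fin n) (Fin n) ℝ) i j - chainA blk pos y μ ε i j =
        chainSign y ε i * ((1 : Matrix (Fin n) (Fin n) ℝ) i j - chainA blk pos y μ 1 i j) := by
      simp only [chainA, chainSign, Matrix.of_apply, Matrix.one_apply]
      by_cases hi : i = y
      · subst hi
        simp only [if_true, eq_comm (a := i)]
        split_ifs <;> ring
      · simp [hi]
    have hB : ∀ a, chainB p blk pos y μ ε i a = chainSign y ε i * chainB p blk pos y μ 1 i a := by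
      intro a
      simp only [chainB, chainSign, Matrix.of_apply]
      split_ifs <;> ring
    rw [Matrix.diagonal_mul]
    simp only [Matrix.sub_apply, Matrix.add_apply, Matrix.mul_apply, hB, mul_assoc,
      ← Finset.mul_sum]
    linear_combination hA
  rw [this, Matrix.det_mul, Matrix.det_diagonal]
  congr 1
  simp [chainSign]

end Chain

/-! ### Membership of the chain systems in the class -/

section ChainClass

variable {n p κ : ℕ} {q : ℕ → ℕ} {blk pos : Fin n → ℕ}

theorem mul_transpose_eq_of_diagonal {a b : ℕ} (hab : a ≤ b) {X : Matrix (Fin a) (Fin b) ℝ}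
    {μ : ℝ} (c : Fin a → ℝ) (hc : ∀ i, c i ^ 2 = μ ^ 2)
    (hX : ∀ i j, X i j = if (i : ℕ) = j then c i else 0) : X * Xᵀ = μ ^ 2 • 1 := by
  ext i k
  rw [Matrix.mul_apply, Finset.sum_eq_single ⟨i, i.2.trans_le hab⟩]
  · by_cases hik : i = k
    · subst hik
      simp [hX, ← hc i, sq]
    · have : (k : ℕ) ≠ i := fun h => hik (Fin.ext h.symm)
      simp [hX, hik, this]
  · intro j _ hj
    have : (i : ℕ) ≠ j := fun h => hj (Fin.ext h.symm)
    simp [hX, this]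
  · simp

theorem StairShape.isRobustlyCoupled_chain (h : StairShape p κ q blk pos) {y : Fin n}
    (hy : blk y + 1 = κ) {μ ε : ℝ} (hμ : 0 < μ) (hε : ε ^ 2 = 1) (hκ : κ ≤ n)
    (hq : ∀ b < κ, 1 ≤ q b) :
    IsRobustlyCoupled μ (chainA blk pos y μ ε) (chainB p blk pos y μ ε) := by
  set A := chainA blk pos y μ ε
  set B := chainB p blk pos y μ ε
  have hAe : ∀ i j, A i j = (if i = y then if j = y then 1 else 0 else 0) +
    μ * chainSign y ε i * if blk i = blk j + 1 ∧ pos i = pos j then 1 else 0 := fun _ _ => rfl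
  have hBe : ∀ i b, B i b = μ * chainSign y ε i * if blk i = 0 ∧ pos i = b then 1 else 0 :=
    fun _ _ => rfl
  have hind : ctrbIndex A B = κ := h.ctrbIndex_eq hy hμ.ne' hε
  have hbs : ∀ b < κ, blockSize A B b = q b := fun b => h.blockSize_eq hy hμ.ne' hε
  have hsign : ∀ i, (μ * chainSign y ε i) ^ 2 = μ ^ 2 := fun i => by
    rw [mul_pow, chainSign_sq y hε, mul_one]
  let f : Fin n → StairIdx A B := fun i => ⟨⟨blk i, hind.symm ▸ h.blk_lt i⟩,
    ⟨pos i, by rw [hbs _ (h.blk_lt i)]; exact h.pos_lt i⟩⟩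
  have hf : ∀ s : StairIdx A B, ∃ i, f i = s := by
    rintro ⟨⟨b, hb⟩, ⟨a, ha⟩⟩
    rw [hind] at hb
    obtain ⟨i, hi, hi'⟩ := h.surj b a (by rwa [← hbs b hb])
    subst hi hi'
    exact ⟨i, rfl⟩
  have hinj : Function.Injective f := fun i j hij =>
    h.inj i j (congrArg (fun s : StairIdx A B => (s.1 : ℕ)) hij)
      (congrArg (fun s : StairIdx A B => (s.2 : ℕ)) hij)
  choose g hg using hf
  have hgf : ∀ i s, (f i = s ↔ i = g s) := fun i s =>
    ⟨fun hi => hinj (hi.trans (hg s).symm), fun hi => hi ▸ hg s⟩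
  have hgb : ∀ s, blk (g s) = s.1 := fun s => congrArg (fun s : StairIdx A B => (s.1 : ℕ)) (hg s)
  have hgp : ∀ s, pos (g s) = s.2 := fun s => congrArg (fun s : StairIdx A B => (s.2 : ℕ)) (hg s)
  -- The chain is already in staircase form up to relabelling coordinates by block and position, so
  -- a permutation matrix suffices.
  let U : Matrix (Fin n) (StairIdx A B) ℝ := Matrix.of fun i s => if f i = s then 1 else 0
  have hUl : ∀ {m : ℕ} (X : Matrix (Fin n) (Fin m) ℝ) s b, (Uᵀ * X) s b = X (g s) b := by
    intro m X s b
    simp [U, Matrix.mul_apply, hgf]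
  have hUr : ∀ (X : Matrix (StairIdx A B) (Fin n) ℝ) s s', (X * U) s s' = X s (g s') := by
    intro X s s'
    simp [U, Matrix.mul_apply, hgf]
  have hin : ∀ i a b, inputBlock A B U i a b = B (g ⟨i, a⟩) b := fun i a b => hUl B _ _
  have hst : ∀ i j a b, stateBlock A B U i j a b = A (g ⟨i, a⟩) (g ⟨j, b⟩) := fun i j a b => by
    rw [stateBlock, Matrix.submatrix_apply, hUr, hUl]
  refine ⟨hμ, ⟨κ, hκ, ?_⟩, U, ⟨?_, ?_, ?_, ?_⟩, ?_, ?_⟩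
  · rw [h.rank_ctrbMatrix hy hμ.ne' hε le_rfl, Finset.filter_true_of_mem fun i _ => h.blk_lt i]
    simp
  · ext s s'
    rw [hUr]
    simp only [U, Matrix.transpose_apply, Matrix.of_apply, hg, Matrix.one_apply]
    simp only [eq_comm]
  · ext i j
    simp [U, Matrix.mul_apply, Matrix.one_apply, hinj.eq_iff, eq_comm]
  · intro i hi
    ext a b
    rw [hin, hBe, hgb, if_neg (fun hh => hi.ne' hh.1)]
    simp
  · intro i j hij
    ext a b
    have h1 : ¬ (g ⟨i, a⟩ = y ∧ g ⟨j, b⟩ = y) := fun hh => by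
      have h2 := hgb ⟨i, a⟩
      have h3 := hgb ⟨j, b⟩
      rw [hh.1] at h2
      rw [hh.2] at h3
      simp only at h2 h3
      omega
    rw [hst, hAe, hgb, hgb, ← ite_and, if_neg h1]
    have h2 : ¬ ((i : ℕ) = j + 1) := by omega
    simp [h2]
  · intro i hi
    have hi0 : blockSize A B i = p := by
      rw [hi, hbs 0 (by have := h.blk_lt y; omega), h.q_zero]
    have hp : 1 ≤ p := h.q_zero ▸ hq 0 (by omega)
    refine le_sigmaVal_of_mul_transpose_eq hμ
      (mul_transpose_eq_of_diagonal hi0.le (fun a => μ * chainSign y ε (g ⟨i, a⟩))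
        (fun a => hsign _) fun a b => ?_) hi0.symm hp
    rw [hin, hBe, hgb, hgp]
    simp [hi]
  · intro i j hij
    have hj : (j : ℕ) < κ := by have := j.2; omega
    have hqi := hbs i (by omega)
    have hqj := hbs j hj
    refine le_sigmaVal_of_mul_transpose_eq hμ (mul_transpose_eq_of_diagonal ?_
      (fun a => μ * chainSign y ε (g ⟨j, a⟩)) (fun a => hsign _) fun a b => ?_) rfl ?_
    · rw [hqi, hqj, hij]; exact h.anti _
    · have h1 : ¬ (g ⟨j, a⟩ = y ∧ g ⟨i, b⟩ = y) := fun hh => by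
        have h2 := hgb ⟨j, a⟩
        have h3 := hgb ⟨i, b⟩
        rw [hh.1] at h2
        rw [hh.2] at h3
        simp only at h2 h3
        omega
      rw [hst, hAe, hgb, hgb, hgp, hgp, ← ite_and, if_neg h1]
      simp [hij]
    · rw [hqj]; exact hq j hj

theorem StairShape.chainSys_mem_robustClass (h : StairShape p κ q blk pos) {y : Fin n}
    (hy : blk y + 1 = κ) {μ ε M : ℝ} (hμ : 0 < μ) (hμ₁ : μ < 1) (hε : ε ^ 2 = 1) (hM : 1 ≤ M)
    (hMκ : 2 ≤ κ → √(1 + μ ^ 2) ≤ M) (hκ : κ ≤ n) (hq : ∀ b < κ, 1 ≤ q b) :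
    chainSys p blk pos y μ ε ∈ robustClass n p κ μ M := by
  have hM2 : 1 ≤ M ^ 2 := by nlinarith
  have hB := h.chainB_transpose_mul y μ hε
  have hH : (chainH y)ᵀ * chainH y = (1 : ℝ) • 1 := by rw [one_smul]; exact chainH_transpose_mul y
  refine ⟨h.norm_chainA_le hy hε hM hMκ, ?_, ?_, rank_eq_of_transpose_mul (by positivity) hB,
    rank_eq_of_transpose_mul one_ne_zero hH, rho_chainA_le_one y μ ε,
    h.isRobustlyCoupled_chain hy hμ hε hκ hq, h.ctrbIndex_eq hy hμ.ne' hε⟩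
  · refine norm_le_of_transpose_mul (by linarith) hB ?_
    rw [abs_of_nonneg (by positivity)]
    nlinarith
  · refine norm_le_of_transpose_mul (by linarith) hH ?_
    rwa [abs_one]

theorem rank_ctrbMatrix_zero (A : Matrix (Fin n) (Fin n) ℝ) (B : Matrix (Fin n) (Fin p) ℝ) :
    (ctrbMatrix A B 0).rank = 0 := by
  have := (ctrbMatrix A B 0).rank_le_card_width
  simpa using this

theorem rank_ctrbMatrix_one (A : Matrix (Fin n) (Fin n) ℝ) (B : Matrix (Fin n) (Fin p) ℝ) :
    (ctrbMatrix A B 1).rank = B.rank := by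
  have : ctrbMatrix A B 1 = B.submatrix (Equiv.refl _) (Equiv.uniqueProd (Fin p) (Fin 1)) := by
    ext i ta
    obtain ⟨t, a⟩ := ta
    simp [ctrbMatrix, Subsingleton.elim t 0]
  rw [this, Matrix.rank_submatrix]

/-- The staircase form of a system of the class gives the shape of its blocks. -/
theorem exists_stairShape_of_mem_robustClass (hn : 1 ≤ n) {μ M : ℝ} (hμ : 0 < μ) {S : LinSys n p}
    (hS : S ∈ robustClass n p κ μ M) :
    1 ≤ κ ∧ κ ≤ n ∧ ∃ (q : ℕ → ℕ) (blk pos : Fin n → ℕ),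
      StairShape p κ q blk pos ∧ ∀ b < κ, 1 ≤ q b := by
  obtain ⟨_, _, _, hBr, _, _, ⟨_, ⟨k, hkn, hk⟩, U, hU, _, hsub⟩, hκ⟩ := hS
  have hk1 : 1 ≤ k := by
    by_contra hk0
    rw [show k = 0 by omega, rank_ctrbMatrix_zero] at hk
    omega
  have hmem : ctrbIndex S.A S.B ∈ {k : ℕ | 1 ≤ k ∧ (ctrbMatrix S.A S.B k).rank = n} :=
    Nat.sInf_mem ⟨k, hk1, hk⟩
  have hκn : ctrbIndex S.A S.B ≤ n :=
    le_trans (Nat.sInf_le (show k ∈ {k : ℕ | 1 ≤ k ∧ (ctrbMatrix S.A S.B k).rank = n} from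
      ⟨hk1, hk⟩)) hkn
  subst hκ
  have hcard : Fintype.card (StairIdx S.A S.B) = n := by
    refine le_antisymm ?_ ?_
    · have h1 := Matrix.rank_mul_le_left Uᵀ U
      rw [hU.transpose_mul, Matrix.rank_one] at h1
      exact h1.trans (by simpa using Uᵀ.rank_le_card_width)
    · have h1 := Matrix.rank_mul_le_left U Uᵀ
      rw [hU.mul_transpose, Matrix.rank_one] at h1
      simpa using h1.trans U.rank_le_card_width
  let e : Fin n ≃ StairIdx S.A S.B := (Fintype.equivFinOfCardEq hcard).symm
  -- Sizes are set to `0` from index `κ` on, so that monotonicity holds for all indices.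
  let q : ℕ → ℕ := fun b => if b < ctrbIndex S.A S.B then blockSize S.A S.B b else 0
  have hqlt : ∀ b < ctrbIndex S.A S.B, q b = blockSize S.A S.B b := fun b hb => if_pos hb
  have hanti : ∀ b, q (b + 1) ≤ q b := by
    intro b
    by_cases hb : b + 1 < ctrbIndex S.A S.B
    · rw [hqlt _ hb, hqlt b (by omega)]
      -- A subdiagonal block whose singular value of index its height is positive cannot be taller
      -- than wide: this is where robust coupling makes the sizes non-increasing.
      exact (le_of_sigmaVal_pos (hμ.trans_le (hsub ⟨b, by omega⟩ ⟨b + 1, hb⟩ rfl))).2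
    · simp [q, hb]
  refine ⟨hmem.1, hκn, q, fun i => (e i).1, fun i => (e i).2, ⟨?_, ?_, ?_, ?_, ?_, hanti⟩, ?_⟩
  · intro i j hij hij'
    refine e.injective ?_
    revert hij hij'
    generalize e i = s
    generalize e j = s'
    obtain ⟨b, a⟩ := s
    obtain ⟨b', a'⟩ := s'
    intro h1 h2
    obtain rfl : b = b' := Fin.ext h1
    obtain rfl : a = a' := Fin.ext h2
    rfl
  · intro b a ha
    by_cases hb : b < ctrbIndex S.A S.B
    · rw [hqlt b hb] at ha
      let s : StairIdx S.A S.B := ⟨⟨b, hb⟩, ⟨a, ha⟩⟩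
      exact ⟨e.symm s, congrArg (fun s : StairIdx S.A S.B => (s.1 : ℕ)) (e.apply_symm_apply s),
        congrArg (fun s : StairIdx S.A S.B => (s.2 : ℕ)) (e.apply_symm_apply s)⟩
    · simp [q, hb] at ha
  · intro i
    rw [hqlt _ (e i).1.2]
    exact (e i).2.2
  · exact fun i => (e i).1.2
  · rw [hqlt 0 hmem.1, blockSize, zero_add, rank_ctrbMatrix_one, rank_ctrbMatrix_zero, hBr,
      Nat.sub_zero]
  · intro b hb
    -- Minimality of `κ` makes the last block non-empty, and by monotonicity so are all the others.
    have hlast : 1 ≤ q (ctrbIndex S.A S.B - 1) := by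
      have h1 := hmem.1
      rw [hqlt _ (by omega), blockSize, Nat.sub_add_cancel h1, hmem.2]
      have h2 : (ctrbMatrix S.A S.B (ctrbIndex S.A S.B - 1)).rank ≠ n := by
        intro h3
        by_cases h0 : ctrbIndex S.A S.B - 1 = 0
        · rw [h0, rank_ctrbMatrix_zero] at h3; omega
        · exact Nat.notMem_of_lt_sInf (m := ctrbIndex S.A S.B - 1)
            (show ctrbIndex S.A S.B - 1 < ctrbIndex S.A S.B by omega) ⟨by omega, h3⟩
      have h4 := (ctrbMatrix S.A S.B (ctrbIndex S.A S.B - 1)).rank_le_card_height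
      simp only [Fintype.card_fin] at h4
      omega
    exact hlast.trans (antitone_nat_of_succ_le hanti (by omega))

end ChainClass

/-! ### Dynamics of the chain and the noise shift -/

section ChainDynamics

variable {n p κ : ℕ} {q : ℕ → ℕ} {blk pos : Fin n → ℕ} {𝒜 : Type*} [MeasurableSpace 𝒜]

variable (blk pos) in
/-- The signal that drives coordinate `i` of the chain system, up to its sign. -/
noncomputable def chainDrive (μ : ℝ) (i : Fin n) (x : Vec n) (u : Vec p) : ℝ :=
  μ * ((∑ j, if blk i = blk j + 1 ∧ pos i = pos j then x j else 0) +
    ∑ a : Fin p, if blk i = 0 ∧ pos i = a then u a else 0)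

theorem measurable_chainDrive (μ : ℝ) (i : Fin n) :
    Measurable fun z : Vec n × Vec p => chainDrive blk pos μ i z.1 z.2 := by
  unfold chainDrive
  refine Measurable.const_mul (Measurable.add ?_ ?_) _ <;>
  · refine Finset.measurable_fun_sum _ fun j _ => ?_
    split_ifs <;> fun_prop

theorem chain_next_apply (y : Fin n) (μ ε : ℝ) (x : Vec n) (u : Vec p) (w : Vec 1) (i : Fin n) :
    (Matrix.toEuclideanLin (chainA blk pos y μ ε) x + Matrix.toEuclideanLin (chainB p blk pos y μ ε) u
      + Matrix.toEuclideanLin (chainH y) w) i =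
    chainSign y ε i * chainDrive blk pos μ i x u + if i = y then x y + w 0 else 0 := by
  have h1 : (Matrix.toEuclideanLin (chainA blk pos y μ ε) x) i =
      ∑ j, chainA blk pos y μ ε i j * x j := by
    simp [Matrix.toLpLin_apply, Matrix.mulVec, dotProduct]
  have h2 : (Matrix.toEuclideanLin (chainB p blk pos y μ ε) u) i =
      μ * chainSign y ε i * ∑ a : Fin p, if blk i = 0 ∧ pos i = a then u a else 0 := by
    simp only [Matrix.toLpLin_apply, Matrix.mulVec, dotProduct, chainB, Matrix.of_apply,
      Finset.mul_sum]
    exact Finset.sum_congr rfl fun a _ => by split_ifs <;> simp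
  have h3 : (Matrix.toEuclideanLin (chainH y) w) i = if i = y then w 0 else 0 := by
    simp [Matrix.toLpLin_apply, Matrix.mulVec, dotProduct, chainH]
  have h4 := sum_chainA_mul (blk := blk) (pos := pos) (RingHom.id ℝ) y μ ε i (fun j => x j)
  simp only [RingHom.id_apply] at h4
  rw [PiLp.add_apply, PiLp.add_apply, h1, h2, h3, h4, chainDrive]
  split_ifs <;> ring

/-- Changing the sign at `y` amounts to shifting the noise. -/
theorem historyStep_chainSys_neg (y : Fin n) (μ : ℝ) (pol : Policy n p 𝒜) (t : ℕ)
    (z : 𝒜 × ((Fin (t + 1) → Vec n) × (Fin t → Vec p))) (w : Vec 1) :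
    historyStep (chainSys p blk pos y μ (-1)) pol t (z, w) =
      historyStep (chainSys p blk pos y μ 1) pol t (z, w + WithLp.toLp 2 fun _ =>
        -2 * chainDrive blk pos μ y (z.2.1 (Fin.last t)) (pol.act t (z.2.1, z.2.2, z.1))) := by
  simp only [historyStep, chainSys]
  congr 3
  ext i
  refine (chain_next_apply y μ (-1) _ _ _ i).trans
    (Eq.trans ?_ (chain_next_apply y μ 1 _ _ _ i).symm)
  by_cases hi : i = y
  · subst hi
    simp [chainSign]
    ring
  · simp [chainSign, hi]

end ChainDynamics

/-! ### Input energy along trajectories -/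

section Energy

variable {n p : ℕ} {𝒜 : Type*} [MeasurableSpace 𝒜]

/-- The state at time `t`. -/
noncomputable def stateAt (S : LinSys n p) (pol : Policy n p 𝒜) (t : ℕ)
    (ω : 𝒜 × (ℕ → Vec S.r)) : Vec n :=
  (history S pol ω.1 ω.2 t).1 (Fin.last t)

/-- The input at time `t`. -/
noncomputable def inputAt (S : LinSys n p) (pol : Policy n p 𝒜) (t : ℕ)
    (ω : 𝒜 × (ℕ → Vec S.r)) : Vec p :=
  pol.act t ((history S pol ω.1 ω.2 t).1, (history S pol ω.1 ω.2 t).2, ω.1)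

theorem stateAt_zero (S : LinSys n p) (pol : Policy n p 𝒜) (ω : 𝒜 × (ℕ → Vec S.r)) :
    stateAt S pol 0 ω = 0 := rfl

theorem stateAt_succ (S : LinSys n p) (pol : Policy n p 𝒜) (t : ℕ) (ω : 𝒜 × (ℕ → Vec S.r)) :
    stateAt S pol (t + 1) ω = Matrix.toEuclideanLin S.A (stateAt S pol t ω) +
      Matrix.toEuclideanLin S.B (inputAt S pol t ω) + Matrix.toEuclideanLin S.H (ω.2 t) := by
  simp [stateAt, inputAt, history]

theorem history_snd_apply (S : LinSys n p) (pol : Policy n p 𝒜) (ω : 𝒜 × (ℕ → Vec S.r)) {N t : ℕ}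
    (ht : t < N) : (history S pol ω.1 ω.2 N).2 ⟨t, ht⟩ = inputAt S pol t ω := by
  induction N with
  | zero => omega
  | succ N ih =>
    rcases Nat.lt_succ_iff_lt_or_eq.1 ht with h | rfl
    · rw [← ih h]
      exact Fin.snoc_castSucc (α := fun _ => Vec p) _ _ ⟨t, h⟩
    · exact Fin.snoc_last (α := fun _ => Vec p) _ _

/-- The data as a function of the history. -/
def dataOfHistory (n p : ℕ) (𝒜 : Type*) (N : ℕ)
    (z : 𝒜 × ((Fin (N + 1) → Vec n) × (Fin N → Vec p))) : Fin N → Vec p × Vec n :=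
  fun t => (z.2.2 t, z.2.1 t.succ)

theorem measurable_dataOfHistory (N : ℕ) : Measurable (dataOfHistory n p 𝒜 N) := by
  unfold dataOfHistory
  fun_prop

theorem dataLaw_eq_map (S : LinSys n p) (pol : Policy n p 𝒜) (ν : Measure 𝒜) (N : ℕ) :
    dataLaw S pol ν N = (historyLaw S pol ν N).map (dataOfHistory n p 𝒜 N) := by
  rw [historyLaw, Measure.map_map (measurable_dataOfHistory N) (measurable_signalHistory S pol N)]
  rfl

theorem EnergyBounded.lintegral_inputAt_le {S : LinSys n p} {pol : Policy n p 𝒜} {ν : Measure 𝒜}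
    {N : ℕ} {σ : ℝ} (h : EnergyBounded S pol ν N σ) {t : ℕ} (ht : t < N) :
    ∫⁻ ω, ‖inputAt S pol t ω‖ₑ ^ 2
      ∂(ν.prod (Measure.infinitePi fun _ : ℕ => stdGaussian (Vec S.r))) ≤
      ENNReal.ofReal (σ ^ 2) := by
  have := h ⟨t, ht⟩
  rw [dataLaw_eq_map, historyLaw, Measure.map_map (measurable_dataOfHistory N)
    (measurable_signalHistory S pol N), lintegral_map (by fun_prop)
    ((measurable_dataOfHistory N).comp (measurable_signalHistory S pol N))] at this
  refine le_trans (lintegral_mono fun ω => ?_) this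
  rw [← history_snd_apply S pol ω ht]
  rfl

end Energy

section ChainEnergy

variable {n p κ : ℕ} {q : ℕ → ℕ} {blk pos : Fin n → ℕ} {𝒜 : Type*} [MeasurableSpace 𝒜]

/-- Along the chain, the energy of the inputs decays by the factor `μ ^ 2` per block. -/
theorem StairShape.lintegral_chainDrive_le (h : StairShape p κ q blk pos) {y : Fin n}
    (hy : blk y + 1 = κ) (μ ε : ℝ) {pol : Policy n p 𝒜} {ν : Measure 𝒜} {N : ℕ} {σ : ℝ}
    (hE : EnergyBounded (chainSys p blk pos y μ ε) pol ν N σ) {t : ℕ} (ht : t < N) (i : Fin n) :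
    ∫⁻ ω, ENNReal.ofReal (chainDrive blk pos μ i (stateAt (chainSys p blk pos y μ ε) pol t ω)
        (inputAt (chainSys p blk pos y μ ε) pol t ω) ^ 2)
      ∂(ν.prod (Measure.infinitePi fun _ : ℕ =>
        stdGaussian (Vec (chainSys p blk pos y μ ε).r))) ≤
      ENNReal.ofReal ((μ ^ 2) ^ (blk i + 1) * σ ^ 2) := by
  set S := chainSys p blk pos y μ ε
  obtain ⟨b, hb⟩ : ∃ b, blk i = b := ⟨_, rfl⟩
  induction b generalizing i t with
  | zero =>
    rw [hb, zero_add, pow_one, ENNReal.ofReal_mul (sq_nonneg μ)]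
    refine le_trans (le_trans (lintegral_mono fun ω => ?_)
      (lintegral_const_mul' (ENNReal.ofReal (μ ^ 2)) _ ENNReal.ofReal_ne_top).le)
      (mul_le_mul_right (hE.lintegral_inputAt_le ht) _)
    have hdr : chainDrive blk pos μ i (stateAt S pol t ω) (inputAt S pol t ω) =
        μ * inputAt S pol t ω ⟨pos i, h.pos_lt_p i⟩ := by
      rw [chainDrive, sum_pred_of_zero hb, zero_add, Finset.sum_eq_single ⟨pos i, h.pos_lt_p i⟩]
      · rw [if_pos ⟨hb, rfl⟩]
      · intro a _ ha
        exact if_neg fun hh => ha (Fin.ext hh.2.symm)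
      · simp
    rw [hdr, mul_pow, ENNReal.ofReal_mul (sq_nonneg μ)]
    refine mul_le_mul_right ?_ _
    rw [← ofReal_norm, ← ENNReal.ofReal_pow (norm_nonneg _)]
    refine ENNReal.ofReal_le_ofReal ?_
    rw [← sq_abs, ← Real.norm_eq_abs]
    exact pow_le_pow_left₀ (norm_nonneg _) (PiLp.norm_apply_le _ _) 2
  | succ b ih =>
    obtain ⟨j, hj, hj'⟩ := h.exists_pred (i := i) (by omega)
    have hjy : j ≠ y := by rintro rfl; have := h.blk_lt i; omega
    have hdr : ∀ ω, chainDrive blk pos μ i (stateAt S pol t ω) (inputAt S pol t ω) =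
        μ * stateAt S pol t ω j := by
      intro ω
      rw [chainDrive, h.sum_pred hj hj', Finset.sum_eq_zero, add_zero]
      exact fun a _ => if_neg fun hh => by omega
    simp only [hdr]
    -- At time `0` the state is zero and so is the drive. Later, the predecessor `j ≠ y` neither
    -- integrates nor receives noise, so its state is its own drive one step earlier.
    rcases t with _ | t
    · simp [stateAt_zero]
    · have hst : ∀ ω, stateAt S pol (t + 1) ω j =
          chainDrive blk pos μ j (stateAt S pol t ω) (inputAt S pol t ω) := by
        intro ω
        rw [stateAt_succ]
        refine (chain_next_apply y μ ε _ _ _ j).trans ?_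
        simp [chainSign, hjy]
      simp only [hst, mul_pow, ENNReal.ofReal_mul (sq_nonneg μ)]
      rw [lintegral_const_mul' _ _ ENNReal.ofReal_ne_top, hj, pow_succ' (μ ^ 2) (blk j + 1),
        mul_assoc, ENNReal.ofReal_mul (sq_nonneg μ)]
      exact mul_le_mul_right (ih (by omega) j (by omega)) _

end ChainEnergy

/-! ### The test defined by the sign of the determinant -/

section Testing

theorem measurable_det_one_sub {n p N : ℕ} (A : Matrix (Fin n) (Fin n) ℝ)
    (B : Matrix (Fin n) (Fin p) ℝ) (K : GainEstimator n p N) :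
    Measurable fun d => (1 - (A + B * K.gain d)).det := by
  simp only [Matrix.det_apply', Matrix.sub_apply, Matrix.add_apply, Matrix.mul_apply]
  refine Finset.measurable_fun_sum _ fun τ _ => Measurable.const_mul ?_ _
  refine Finset.measurable_fun_prod _ fun i _ => measurable_const.sub (measurable_const.add ?_)
  exact Finset.measurable_fun_sum _ fun j _ => (K.measurable_gain j i).const_mul _

/-- The variational inequality for the indicator of an event. -/
theorem variational_of_event {Ω : Type*} [MeasurableSpace Ω] {P Q : Measure Ω}
    [IsProbabilityMeasure P] [IsProbabilityMeasure Q] {D δ : ℝ} {G : Set Ω} (hG : MeasurableSet G)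
    (hδ : 0 ≤ δ) (h : ∀ (f : Ω → ℝ) (C : ℝ), Measurable f → (∀ x, |f x| ≤ C) →
      ∫ x, f x ∂Q ≤ Real.log (∫ x, Real.exp (f x) ∂P) + D)
    (hP : P G ≤ ENNReal.ofReal δ) (hQ : Q Gᶜ ≤ ENNReal.ofReal δ) {c : ℝ} (hc : 0 ≤ c) :
    c * (1 - δ) ≤ Real.log (1 + (Real.exp c - 1) * δ) + D := by
  have hP' : P.real G ≤ δ := ENNReal.toReal_le_of_le_ofReal hδ hP
  have hQ' : 1 - δ ≤ Q.real G := by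
    have h1 : Q.real Gᶜ ≤ δ := ENNReal.toReal_le_of_le_ofReal hδ hQ
    rw [probReal_compl_eq_one_sub hG] at h1
    linarith
  have hexp : 0 ≤ Real.exp c - 1 := by linarith [Real.one_le_exp hc]
  have hind := h (G.indicator fun _ => c) c (measurable_const.indicator hG) fun x => by
    by_cases hx : x ∈ G <;> simp [hx, abs_of_nonneg hc, hc]
  have h1 : ∫ x, G.indicator (fun _ => c) x ∂Q = c * Q.real G := by
    rw [integral_indicator_const _ hG, smul_eq_mul, mul_comm]
  have h2 : ∫ x, Real.exp (G.indicator (fun _ => c) x) ∂P = 1 + (Real.exp c - 1) * P.real G := by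
    have : ∀ x, Real.exp (G.indicator (fun _ => c) x) =
        1 + G.indicator (fun _ => Real.exp c - 1) x := fun x => by
      by_cases hx : x ∈ G <;> simp [hx]
    simp only [this]
    rw [integral_add (integrable_const _) ((integrable_const _).indicator hG),
      integral_indicator_const _ hG, smul_eq_mul, mul_comm]
    simp
  rw [h1, h2] at hind
  have h3 : Real.log (1 + (Real.exp c - 1) * P.real G) ≤ Real.log (1 + (Real.exp c - 1) * δ) := by
    refine Real.log_le_log (by positivity) ?_
    have := mul_le_mul_of_nonneg_left hP' hexp
    linarith
  have h4 := mul_le_mul_of_nonneg_left hQ' hc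
  linarith

end Testing

/-! ### The lower bound -/

/-- Stabilization from data can be hard. A requirement with `δ = 0`, where the right-hand side of
the bound is `+∞`, can never be met. -/
theorem mainTheorem1 (n p κ N : ℕ) (hn : 1 ≤ n) (μ M σ δ : ℝ)
    (hμ₀ : 0 < μ) (hμ₁ : μ < 1)
    (hM : 1 ≤ M) (hMκ : 2 ≤ κ → √(1 + μ ^ 2) ≤ M)
    (hC : (robustClass n p κ μ M).Nonempty)
    (hσ : 0 < σ) (hδ₀ : 0 ≤ δ) (hδ₁ : δ < 1 / 2)
    {𝒜 : Type*} [MeasurableSpace 𝒜] (ν : Measure 𝒜) [IsProbabilityMeasure ν]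
    (pol : Policy n p 𝒜) (K : GainEstimator n p N)
    (hE : ∀ S ∈ robustClass n p κ μ M, EnergyBounded S pol ν N σ)
    (hreq : (⨆ S ∈ robustClass n p κ μ M, failureProb S pol ν N K) ≤ ENNReal.ofReal δ) :
    0 < δ ∧
      (N : ℝ) * σ ^ 2 ≥
        1 / 2 * (1 / μ) ^ (2 * κ - 2) * ((1 - μ) / μ) ^ 2 * Real.log (1 / (3 * δ)) := by
  obtain ⟨S₀, hS₀⟩ := hC
  obtain ⟨hκ1, hκn, q, blk, pos, h, hq⟩ := exists_stairShape_of_mem_robustClass hn hμ₀ hS₀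
  -- The last block, so that the input is attenuated by all `κ` gains before it acts on `y`.
  obtain ⟨y, hyb, -⟩ := h.surj (κ - 1) 0 (hq _ (by omega))
  have hy : blk y + 1 = κ := by omega
  have hmem : ∀ ε : ℝ, ε ^ 2 = 1 → chainSys p blk pos y μ ε ∈ robustClass n p κ μ M :=
    fun ε hε => h.chainSys_mem_robustClass hy hμ₀ hμ₁ hε hM hMκ hκn hq
  have hmem₁ := hmem 1 (by norm_num)
  have hmem₂ := hmem (-1) (by norm_num)
  set S₁ : LinSys n p := chainSys p blk pos y μ 1
  set S₂ : LinSys n p := chainSys p blk pos y μ (-1)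
  have hfail : ∀ S ∈ robustClass n p κ μ M, failureProb S pol ν N K ≤ ENNReal.ofReal δ :=
    fun S hS => (le_iSup₂ (f := fun S _ => failureProb S pol ν N K) S hS).trans hreq
  let v : (t : ℕ) → 𝒜 × ((Fin (t + 1) → Vec n) × (Fin t → Vec p)) → Vec 1 := fun t z =>
    WithLp.toLp 2 fun _ => -2 * chainDrive blk pos μ y (z.2.1 (Fin.last t))
      (pol.act t (z.2.1, z.2.2, z.1))
  have hdrive : ∀ t, Measurable fun z : 𝒜 × ((Fin (t + 1) → Vec n) × (Fin t → Vec p)) =>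
      chainDrive blk pos μ y (z.2.1 (Fin.last t)) (pol.act t (z.2.1, z.2.2, z.1)) := fun t =>
    (measurable_chainDrive μ y).comp (Measurable.prodMk (by fun_prop)
      ((pol.measurable_act t).comp (by fun_prop)))
  have hv : ∀ t, Measurable (v t) := fun t => by
    have := (hdrive t).const_mul (-2)
    fun_prop
  have hvn : ∀ t z, ‖v t z‖ ^ 2 = 4 * chainDrive blk pos μ y (z.2.1 (Fin.last t))
      (pol.act t (z.2.1, z.2.2, z.1)) ^ 2 := fun t z => by
    rw [EuclideanSpace.real_norm_sq_eq]
    simp [v, mul_pow]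
    norm_num
  have hvm : ∀ t, Measurable fun z => ‖v t z‖ ^ 2 := fun t => (hv t).norm.pow_const 2
  have hlint : ∀ t < N, ∫⁻ z, ENNReal.ofReal (‖v t z‖ ^ 2) ∂(historyLaw S₂ pol ν t) ≤
      ENNReal.ofReal (4 * (μ ^ (2 * κ) * σ ^ 2)) := by
    intro t ht
    rw [historyLaw, lintegral_map (hvm t).ennreal_ofReal (measurable_signalHistory S₂ pol t)]
    simp only [hvn, ENNReal.ofReal_mul (show (0 : ℝ) ≤ 4 by norm_num)]
    rw [lintegral_const_mul' _ _ ENNReal.ofReal_ne_top]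
    have := h.lintegral_chainDrive_le hy μ (-1) (hE S₂ hmem₂) ht y
    rw [hy, ← pow_mul] at this
    exact mul_le_mul_right this _
  have hint : ∀ t < N, Integrable (fun z => ‖v t z‖ ^ 2) (historyLaw S₂ pol ν t) := by
    intro t ht
    refine ⟨(hvm t).aestronglyMeasurable, ?_⟩
    rw [hasFiniteIntegral_iff_ofReal (.of_forall fun z => sq_nonneg _)]
    exact (hlint t ht).trans_lt ENNReal.ofReal_lt_top
  have hbound : ∀ t < N, ∫ z, ‖v t z‖ ^ 2 ∂(historyLaw S₂ pol ν t) ≤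
      4 * (μ ^ (2 * κ) * σ ^ 2) := by
    intro t ht
    rw [integral_eq_lintegral_of_nonneg_ae (.of_forall fun z => sq_nonneg _)
      (hvm t).aestronglyMeasurable]
    exact ENNReal.toReal_le_of_le_ofReal (by positivity) (hlint t ht)
  let det₁ : (Fin N → Vec p × Vec n) → ℝ := fun d => (1 - (S₁.A + S₁.B * K.gain d)).det
  have hdet : ∀ d, (1 - (S₂.A + S₂.B * K.gain d)).det = -1 * det₁ d := fun d =>
    det_one_sub_chain y μ (-1) (K.gain d)
  -- On this event the gain fails for `S₁`; on its complement the determinant for `S₂` is negative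
  -- and the gain fails for `S₂`. Unlike the failure events themselves, it is evidently measurable.
  have hG : MeasurableSet {d | det₁ d ≤ 0} :=
    measurableSet_le (measurable_det_one_sub S₁.A S₁.B K) measurable_const
  have hP : historyLaw S₁ pol ν N (dataOfHistory n p 𝒜 N ⁻¹' {d | det₁ d ≤ 0}) ≤
      ENNReal.ofReal δ := by
    rw [← Measure.map_apply (measurable_dataOfHistory N) hG, ← dataLaw_eq_map]
    exact le_trans (measure_mono fun d hd => one_le_rho_of_det_nonpos hd) (hfail S₁ hmem₁)
  have hQ : historyLaw S₂ pol ν N (dataOfHistory n p 𝒜 N ⁻¹' {d | det₁ d ≤ 0})ᶜ ≤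
      ENNReal.ofReal δ := by
    rw [← Set.preimage_compl, ← Measure.map_apply (measurable_dataOfHistory N) hG.compl,
      ← dataLaw_eq_map]
    refine le_trans (measure_mono fun d hd => one_le_rho_of_det_nonpos ?_) (hfail S₂ hmem₂)
    rw [hdet]
    have : 0 < det₁ d := not_le.1 hd
    linarith
  -- `D` is half of `N` times the bound `4 * (μ ^ (2 * κ) * σ ^ 2)`, where the `4` is the square of
  -- the factor in the shift.
  obtain ⟨hδ, hlog⟩ := log_le_of_forall_variational (D := 2 * (N * (μ ^ (2 * κ) * σ ^ 2))) hδ₀ hδ₁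
    fun c hc => variational_of_event (measurable_dataOfHistory N hG) hδ₀
      (fun f C hf hfC => by
        have h1 := integral_historyLaw_le_log_integral_exp pol ν v hv
          (historyStep_chainSys_neg y μ pol) N hint hf hfC
        have h2 := Finset.sum_le_sum fun t ht => hbound t (Finset.mem_range.1 ht)
        rw [Finset.sum_const, Finset.card_range, nsmul_eq_mul] at h2
        refine h1.trans ?_
        refine add_le_add_right ?_ _
        refine (div_le_div_of_nonneg_right h2 zero_le_two).trans (le_of_eq ?_)
        ring) hP hQ hc
  refine ⟨hδ, ?_⟩
  have hfac : (1 / μ) ^ (2 * κ - 2) * ((1 - μ) / μ) ^ 2 = (1 - μ) ^ 2 / μ ^ (2 * κ) := by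
    rw [div_pow, div_pow, one_pow, div_mul_div_comm, one_mul, ← pow_add,
      Nat.sub_add_cancel (by omega)]
  rw [ge_iff_le, mul_assoc (1 / 2 : ℝ), hfac]
  rcases le_or_gt (Real.log (1 / (3 * δ))) 0 with hL | hL
  · refine (mul_nonpos_of_nonneg_of_nonpos (by positivity) hL).trans (by positivity)
  · have hpow : 0 < μ ^ (2 * κ) := by positivity
    -- The argument gives the bound without the factor `(1 - μ) ^ 2`, which is simply estimated by
    -- `1`.
    have hsq : (1 - μ) ^ 2 ≤ 1 := by nlinarith
    calc 1 / 2 * ((1 - μ) ^ 2 / μ ^ (2 * κ)) * Real.log (1 / (3 * δ))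
        ≤ 1 / 2 * (1 / μ ^ (2 * κ)) * (2 * (N * (μ ^ (2 * κ) * σ ^ 2))) := by gcongr
      _ = N * σ ^ 2 := by field_simp
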